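/- Let $R$ be a ring with identity, let $(M_i)_{i\in I}$ be a family of indecomposable left $R$-modules, and let $(M_t)_{t\in T}$, $T\subseteq I$, be a transversal of the isomorphism classes of the $M_i$, i.e. every $M_i$ is isomorphic to $M_t$ for exactly one $t\in T$. For a left $R$-module $M$ put $S=\operatorname{End}_R(M)$ and regard $M$ as a left $S$-module. Then $M$ is *endo-noetherian* (resp. *endofinite*) if it is noetherian (resp. of finite length) over $S$; the *endosocle* of $M$ is the socle of ${}_SM$ (the sum of its simple submodules), and it is called finitely generated if it is so over $S$. The module $M$ is *algebraically compact* if every system of linear equations $\sum_{j} a_{ij}X_j=b_i$ ($a_{ij}\in R$, $b_i\in M$, each equation having only finitely many nonzero coefficients) all of whose finite subsystems are solvable in $M$ is solvable in $M$; it is *$\Sigma$-algebraically compact* if all direct sums of copies of $M$ are algebraically compact. The family $(M_t)_{t\in T}$ is *right T-nilpotent* if for every sequence $(t_n)_{n\ge 1}$ in $T$ (repetitions allowed), all non-isomorphisms $f_n\in\operatorname{Hom}_R(M_{t_n},M_{t_{n+1}})$ and every finitely generated submodule $X$ of $M_{t_1}$ there is $n_0$ with $f_{n_0}\cdots f_1(X)=0$.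 It is *left semi-T-nilpotent* if for every sequence $(t_n)_{n\ge 1}$ of pairwise distinct elements of $T$, all non-isomorphisms $f_n\in\operatorname{Hom}_R(M_{t_{n+1}},M_{t_n})$ and every submodule $X$ of $M_{t_1}$ with $M_{t_1}/X$ finitely cogenerated there is $n_0$ with $\operatorname{Im}(f_1\cdots f_{n_0})\subseteq X$. (A module is finitely cogenerated if every family of submodules with zero intersection has a finite subfamily with zero intersection.) (I) The following statements are equivalent: (1) $\bigoplus_{i\in I}M_i$ is endo-noetherian, and $(M_t)_{t\in T}$ is right T-nilpotent. (2) $T$ is finite, and each $M_t$, $t\in T$, is endofinite. (II) Suppose that $\bigoplus_{i\in I}M_i$ is $\Sigma$-algebraically compact, that $(M_t)_{t\in T}$ is left semi-T-nilpotent, and that for each cofinite subset $T'\subseteq T$ the endosocle of $\bigoplus_{t\in T'}M_t$ is finitely generated. Then $T$ is finite. -/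

import Mathlib

open scoped DirectSum

namespace EndoStructure

universe u v w

/-! A module `M` over `R` is regarded as a (left) module over its endomorphism ring
`Module.End R M`, acting by evaluation. -/

/-- `M` is endo-noetherian: noetherian over its endomorphism ring. -/
def IsEndoNoetherian (R : Type u) (M : Type v) [Ring R] [AddCommGroup M] [Module R M] : Prop :=
  IsNoetherian (Module.End R M) M

/-- `M` is endofinite: of finite length over its endomorphism ring. -/
def IsEndofinite (R : Type u) (M : Type v) [Ring R] [AddCommGroup M] [Module R M] : Prop :=
  IsFiniteLength (Module.End R M) M

/-- The socle of a module: the sum of all its simple submodules. -/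
def socle (S : Type u) (M : Type v) [Ring S] [AddCommGroup M] [Module S M] : Submodule S M :=
  sSup {U : Submodule S M | IsSimpleModule S U}

/-- The endosocle of `M`: its socle over the endomorphism ring. -/
def endosocle (R : Type u) (M : Type v) [Ring R] [AddCommGroup M] [Module R M] :
    Submodule (Module.End R M) M :=
  socle (Module.End R M) M

/-- A module is indecomposable if it is nonzero and is not the direct sum of two nonzero
submodules. -/
def IsIndecomposable (R : Type u) (M : Type v) [Ring R] [AddCommGroup M] [Module R M] : Prop :=
  Nontrivial M ∧ ∀ A B : Submodule R M, IsCompl A B → A = ⊥ ∨ B = ⊥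

/-- A module is finitely cogenerated if every family of submodules with zero intersection has
a finite subfamily with zero intersection. -/
def IsFinitelyCogenerated (R : Type u) (M : Type v) [Ring R] [AddCommGroup M] [Module R M] :
    Prop :=
  ∀ F : Set (Submodule R M), sInf F = ⊥ → ∃ G ⊆ F, G.Finite ∧ sInf G = ⊥

/-- `M` is algebraically compact: every system of linear equations
`∑ j, a i j • X j = b i` (`i ∈ I`), with finitely many nonzero coefficients in each equation,
which is finitely solvable in `M` is solvable in `M`. The cardinality of the system is bounded
by the universe of `R` and `M` only, which is no loss of generality. -/
def IsAlgebraicallyCompact (R : Type u) (M : Type v) [Ring R] [AddCommGroup M] [Module R M] :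
    Prop :=
  ∀ (I J : Type (max u v)) (a : I → J →₀ R) (b : I → M),
    (∀ F : Finset I, ∃ x : J → M, ∀ i ∈ F, ((a i).sum fun j r => r • x j) = b i) →
      ∃ x : J → M, ∀ i, ((a i).sum fun j r => r • x j) = b i

/-- `M` is Σ-algebraically compact: every direct sum of copies of `M` is algebraically
compact. -/
def IsSigmaAlgebraicallyCompact (R : Type u) (M : Type v) [Ring R] [AddCommGroup M]
    [Module R M] : Prop :=
  ∀ K : Type (max u v), IsAlgebraicallyCompact R (K →₀ M)

section Family

variable {R : Type u} {I : Type w} {M : I → Type v} [Ring R] [∀ i, AddCommGroup (M i)]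
  [∀ i, Module R (M i)]

/-- For maps `f n : M (i n) → M (i (n + 1))`, the composite `f (n - 1) ∘ ⋯ ∘ f 1 ∘ f 0` of the
first `n` of them. -/
def forwardComp (i : ℕ → I) (f : ∀ n, M (i n) →ₗ[R] M (i (n + 1))) :
    ∀ n, M (i 0) →ₗ[R] M (i n)
  | 0 => LinearMap.id
  | n + 1 => f n ∘ₗ forwardComp i f n

/-- For maps `f n : M (i (n + 1)) → M (i n)`, the composite `f 0 ∘ f 1 ∘ ⋯ ∘ f (n - 1)` of the
first `n` of them. -/
def backwardComp (i : ℕ → I) (f : ∀ n, M (i (n + 1)) →ₗ[R] M (i n)) :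
    ∀ n, M (i n) →ₗ[R] M (i 0)
  | 0 => LinearMap.id
  | n + 1 => backwardComp i f n ∘ₗ f n

variable (R M)

/-- The family `M` is right T-nilpotent: for every sequence of indices (repetitions allowed),
all non-isomorphisms `f n : M (i n) → M (i (n + 1))` and every finitely generated submodule `X`
of `M (i 0)`, some composite `f (n - 1) ∘ ⋯ ∘ f 0` vanishes on `X`. -/
def IsRightTNilpotent : Prop :=
  ∀ (i : ℕ → I) (f : ∀ n, M (i n) →ₗ[R] M (i (n + 1))),
    (∀ n, ¬ Function.Bijective (f n)) →
      ∀ X : Submodule R (M (i 0)), X.FG → ∃ n, X.map (forwardComp i f n) = ⊥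

/-- The family `M` is left semi-T-nilpotent: for every sequence of pairwise distinct indices,
all non-isomorphisms `f n : M (i (n + 1)) → M (i n)` and every finitely cogenerated factor
module `M (i 0) ⧸ X`, some composite `f 0 ∘ ⋯ ∘ f (n - 1)` has its image contained in `X`. -/
def IsLeftSemiTNilpotent : Prop :=
  ∀ i : ℕ → I, Function.Injective i → ∀ f : ∀ n, M (i (n + 1)) →ₗ[R] M (i n),
    (∀ n, ¬ Function.Bijective (f n)) →
      ∀ X : Submodule R (M (i 0)), IsFinitelyCogenerated R (M (i 0) ⧸ X) →
        ∃ n, LinearMap.range (backwardComp i f n) ≤ X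

/-- `T ⊆ I` indexes a transversal of the isomorphism classes of the `M i`: every `M i` is
isomorphic to `M t` for exactly one `t ∈ T`. -/
def IsTransversal (T : Set I) : Prop :=
  ∀ i, ∃! t, t ∈ T ∧ Nonempty (M i ≃ₗ[R] M t)

end Family

end EndoStructure

/-! Let `S` be the endomorphism ring of the direct sum `D`, with radical `J`. Fully invariant
submodules of `D` are determined by their components at `t ∈ T`, and, once endomorphism rings are
local, non-isomorphisms `M s → M t` are exactly the maps whose extension by zero lies in `J`.

(I) If (2) holds, `D` has finite length over `S`, so a power of `J` kills `D` and long composites of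
non-isomorphisms vanish; locality comes from linear compactness of endo-artinian modules
(`nonempty_sInter_of_isClosedAffine`). Conversely, T-nilpotence forces locality. The Loewy series of
`D` stabilises by noetherianity, and only at `D`, as an element outside would start an endless
nonvanishing composite. Each layer is killed by `J`, hence involves finitely many `t`; so `T` is
finite, and Hopkins–Levitzki gives finite length.

(II) Σ-algebraic compactness yields the descending chain condition on cyclic endosubmodules, hence
simple ones inside every nonzero one. Semi-T-nilpotence makes finitely generated endosocles finitely
supported. For infinite `T`, removing these supports successively leaves infinitely many disjoint
finite layers, each nonzero element of a layer mapping nontrivially into the previous one. A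
Mittag-Leffler argument (`not_isLeftSemiTNilpotent_of_descent`) threads the layers by an infinite
sequence of maps, a contradiction. -/

namespace EndoStructure

/-! ### Idempotents and split maps of indecomposable modules. -/

section Indecomposable

variable {R : Type*} [Ring R] {M N P : Type*} [AddCommGroup M] [Module R M]
  [AddCommGroup N] [Module R N] [AddCommGroup P] [Module R P]

theorem IsIndecomposable.eq_zero_or_eq_one (hM : IsIndecomposable R M) {e : Module.End R M}
    (he : IsIdempotentElem e) : e = 0 ∨ e = 1 := by
  rcases hM.2 _ _ (LinearMap.IsIdempotentElem.isCompl he) with h | h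
  · exact .inl (LinearMap.range_eq_bot.1 h)
  · refine .inr (LinearMap.ext fun x => LinearMap.ker_eq_bot.1 h ?_)
    exact congrArg (fun g : Module.End R M => g x) he.eq

/-- The idempotent `f ∘ g` fixes the nonzero element `f x`, so it must be `1`. -/
theorem IsIndecomposable.bijective_of_comp_eq_id [Nontrivial M] (hN : IsIndecomposable R N)
    {f : M →ₗ[R] N} {g : N →ₗ[R] M} (h : g ∘ₗ f = LinearMap.id) : Function.Bijective f := by
  have hgf : ∀ x, g (f x) = x := fun x => congrArg (fun k : M →ₗ[R] M => k x) h
  have hinj : Function.Injective f := Function.LeftInverse.injective hgf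
  have he : IsIdempotentElem (f ∘ₗ g : Module.End R N) :=
    LinearMap.ext fun y => by simp [hgf]
  rcases hN.eq_zero_or_eq_one he with h0 | h1
  · obtain ⟨x, hx⟩ := exists_ne (0 : M)
    refine absurd ?_ hx
    have : f (g (f x)) = 0 := congrArg (fun k : Module.End R N => k (f x)) h0
    rw [hgf] at this
    exact hinj (this.trans (map_zero f).symm)
  · exact ⟨hinj, fun y => ⟨g y, congrArg (fun k : Module.End R N => k y) h1⟩⟩

theorem IsIndecomposable.bijective_of_bijective_comp [Nontrivial M] (hN : IsIndecomposable R N)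
    {f : M →ₗ[R] N} {g : N →ₗ[R] P} (h : Function.Bijective (g ∘ₗ f)) :
    Function.Bijective f ∧ Function.Bijective g := by
  let e := LinearEquiv.ofBijective _ h
  have hf : Function.Bijective f :=
    hN.bijective_of_comp_eq_id (g := e.symm.toLinearMap ∘ₗ g)
      (LinearMap.ext fun x => e.symm_apply_apply x)
  exact ⟨hf, (Function.Bijective.of_comp_iff g hf).1 h⟩

end Indecomposable

/-! ### Fully invariant submodules of a direct sum. -/

section DirectSum

variable {R : Type*} [Ring R] {I : Type*} [DecidableEq I] {M : I → Type*}
  [∀ i, AddCommGroup (M i)] [∀ i, Module R (M i)]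

/-- An additive subgroup of a direct sum stable under the projections consists of the elements
all of whose homogeneous components it contains. -/
theorem mem_of_forall_lof_mem {W : AddSubgroup (⨁ i, M i)} {x : ⨁ i, M i}
    (h : ∀ i, DirectSum.lof R I M i (x i) ∈ W) : x ∈ W := by
  classical
  rw [← DirectSum.sum_support_of x]
  exact W.sum_mem fun i _ => h i

theorem lof_apply_mem (W : Submodule (Module.End R (⨁ i, M i)) (⨁ i, M i)) {x : ⨁ i, M i}
    (hx : x ∈ W) {j : I} (g : (⨁ i, M i) →ₗ[R] M j) : DirectSum.lof R I M j (g x) ∈ W :=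
  W.smul_mem (DirectSum.lof R I M j ∘ₗ g) hx

theorem lof_map_mem (W : Submodule (Module.End R (⨁ i, M i)) (⨁ i, M i)) {i : I} {x : M i}
    (hx : DirectSum.lof R I M i x ∈ W) {j : I} (f : M i →ₗ[R] M j) :
    DirectSum.lof R I M j (f x) ∈ W := by
  have := lof_apply_mem W hx (f ∘ₗ DirectSum.component R I M i)
  rwa [LinearMap.comp_apply, DirectSum.component.lof_self] at this

theorem mem_iff_forall_lof_mem (W : Submodule (Module.End R (⨁ i, M i)) (⨁ i, M i))
    {x : ⨁ i, M i} : x ∈ W ↔ ∀ i, DirectSum.lof R I M i (x i) ∈ W :=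
  ⟨fun hx i => lof_apply_mem W hx (DirectSum.component R I M i),
    fun h => mem_of_forall_lof_mem (R := R) (W := W.toAddSubgroup) h⟩

theorem exists_lof_notMem {W : Submodule (Module.End R (⨁ i, M i)) (⨁ i, M i)}
    {x : ⨁ i, M i} (hx : x ∉ W) : ∃ i, DirectSum.lof R I M i (x i) ∉ W := by
  simpa using mt (mem_iff_forall_lof_mem W).2 hx

/-- The homogeneous component of a fully invariant submodule of a direct sum. -/
def homogeneousPart (W : Submodule (Module.End R (⨁ i, M i)) (⨁ i, M i)) (i : I) :
    Submodule (Module.End R (M i)) (M i) where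
  carrier := {x | DirectSum.lof R I M i x ∈ W}
  add_mem' hx hy := by simpa using W.add_mem hx hy
  zero_mem' := by simp
  smul_mem' f _ hx := lof_map_mem W hx f

/-- The elements of a direct sum all of whose images in `M i` lie in `V`. -/
def fullyInvariantHull (i : I) (V : Submodule (Module.End R (M i)) (M i)) :
    Submodule (Module.End R (⨁ i, M i)) (⨁ i, M i) where
  carrier := {x | ∀ g : (⨁ i, M i) →ₗ[R] M i, g x ∈ V}
  add_mem' hx hy g := by simpa using V.add_mem (hx g) (hy g)
  zero_mem' g := by simp
  smul_mem' f _ hx g := hx (g ∘ₗ f)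

theorem lof_mem_fullyInvariantHull {i : I} {V : Submodule (Module.End R (M i)) (M i)} {x : M i} :
    DirectSum.lof R I M i x ∈ fullyInvariantHull i V ↔ x ∈ V := by
  refine ⟨fun h => ?_, fun h g => V.smul_mem (g ∘ₗ DirectSum.lof R I M i) h⟩
  simpa using h (DirectSum.component R I M i)

theorem fullyInvariantHull_le_iff {i : I} {V V' : Submodule (Module.End R (M i)) (M i)} :
    fullyInvariantHull i V ≤ fullyInvariantHull i V' ↔ V ≤ V' :=
  ⟨fun h _ hx => lof_mem_fullyInvariantHull.1 (h (lof_mem_fullyInvariantHull.2 hx)),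
    fun h _ hx g => h (hx g)⟩

end DirectSum

/-! ### Linear compactness and local endomorphism rings. -/

section LinearCompactness

variable {R : Type*} [Ring R] {M : Type*} [AddCommGroup M] [Module R M]

/-- A set of endomorphisms is closed affine if it is a coset of a left ideal which is closed in
the topology of pointwise convergence (with `M` discrete), or empty. -/
structure IsClosedAffine (H : Set (Module.End R M)) : Prop where
  mem_of_approx : ∀ g : Module.End R M,
    (∀ F : Finset M, ∃ h ∈ H, ∀ m ∈ F, h m = g m) → g ∈ H
  affine : ∀ h₁ ∈ H, ∀ h₂ ∈ H, ∀ h₃ ∈ H, ∀ s : Module.End R M, h₁ + s * (h₂ - h₃) ∈ H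

/-- Differences of values at `m` form an endosubmodule; this is how the artinian hypothesis acts on
affine sets. -/
theorem exists_direction {H : Set (Module.End R M)} (hne : H.Nonempty)
    (hH : ∀ h₁ ∈ H, ∀ h₂ ∈ H, ∀ h₃ ∈ H, ∀ s : Module.End R M, h₁ + s * (h₂ - h₃) ∈ H) (m : M) :
    ∃ V : Submodule (Module.End R M) M, ∀ v, v ∈ V ↔ ∃ h ∈ H, ∃ h' ∈ H, v = h m - h' m := by
  obtain ⟨h₀, hh₀⟩ := hne
  refine ⟨{ carrier := {v | ∃ h ∈ H, ∃ h' ∈ H, v = h m - h' m}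
            add_mem' := ?_, zero_mem' := ⟨h₀, hh₀, h₀, hh₀, by simp⟩, smul_mem' := ?_ },
    fun v => Iff.rfl⟩
  · rintro _ _ ⟨h, hh, h', hh', rfl⟩ ⟨k, hk, k', hk', rfl⟩
    refine ⟨_, hH h hh k hk k' hk' 1, h', hh', ?_⟩
    simp
    abel
  · rintro s _ ⟨h, hh, h', hh', rfl⟩
    exact ⟨_, hH h' hh' h hh h' hh' s, h', hh', by simp⟩

/-- The endomorphism ring of a module which is artinian over it is linearly compact. -/
theorem nonempty_sInter_of_isClosedAffine [IsArtinian (Module.End R M) M]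
    {𝓗 : Set (Set (Module.End R M))} (h𝓗 : 𝓗.Nonempty) (hdir : DirectedOn (· ⊇ ·) 𝓗)
    (hcl : ∀ H ∈ 𝓗, IsClosedAffine H) (hne : ∀ H ∈ 𝓗, H.Nonempty) : (⋂₀ 𝓗).Nonempty := by
  classical
  -- Members of `P` are relations each finite part of which is interpolated inside every `H`. A
  -- maximal one will contain the graph of a common point.
  let P : Set (Set (M × M)) := {Q | ∀ H ∈ 𝓗, ∀ q : Finset (M × M), ↑q ⊆ Q →
    ∃ h ∈ H, ∀ p ∈ q, h p.1 = p.2}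
  obtain ⟨Q, hQ⟩ : ∃ Q, Maximal (· ∈ P) Q := by
    refine zorn_subset P fun c hc hchain => ⟨⋃₀ c, ?_, fun s => Set.subset_sUnion_of_mem⟩
    intro H hH q hq
    rcases c.eq_empty_or_nonempty with rfl | hcne
    · obtain ⟨h, hh⟩ := hne H hH
      refine ⟨h, hh, fun p hp => ?_⟩
      simpa using hq hp
    · obtain ⟨Q', hQ', hqQ'⟩ := DirectedOn.exists_mem_subset_of_finset_subset_biUnion
        (f := id) hcne hchain.directedOn (by simpa [Set.sUnion_eq_biUnion] using hq)
      exact hc hQ' H hH q hqQ'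
  let sol (H : Set (Module.End R M)) (q : Finset (M × M)) : Set (Module.End R M) :=
    {h ∈ H | ∀ p ∈ q, h p.1 = p.2}
  have hsolne : ∀ H ∈ 𝓗, ∀ q : Finset (M × M), ↑q ⊆ Q → (sol H q).Nonempty :=
    fun H hH q hq => hQ.prop H hH q hq
  have hsol : ∀ H ∈ 𝓗, ∀ q : Finset (M × M), ∀ h₁ ∈ sol H q, ∀ h₂ ∈ sol H q, ∀ h₃ ∈ sol H q,
      ∀ s : Module.End R M, h₁ + s * (h₂ - h₃) ∈ sol H q := by
    refine fun H hH q h₁ hh₁ h₂ hh₂ h₃ hh₃ s =>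
      ⟨(hcl H hH).affine _ hh₁.1 _ hh₂.1 _ hh₃.1 s, fun p hp => ?_⟩
    simp [hh₁.2 p hp, hh₂.2 p hp, hh₃.2 p hp]
  have htotal : ∀ m, ∃ m', (m, m') ∈ Q := by
    intro m
    -- Choose `H`, `q` with the least direction module at `m`. Passing to a common refinement cannot
    -- shrink it, so the value `h m` is attained in every solution set.
    let 𝒱 : Set (Submodule (Module.End R M) M) := {V | ∃ H ∈ 𝓗, ∃ q : Finset (M × M), ↑q ⊆ Q ∧
      ∀ v, v ∈ V ↔ ∃ h ∈ sol H q, ∃ h' ∈ sol H q, v = h m - h' m}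
    have h𝒱 : 𝒱.Nonempty := by
      obtain ⟨H, hH⟩ := h𝓗
      obtain ⟨V, hV⟩ := exists_direction (hsolne H hH ∅ (by simp)) (hsol H hH ∅) m
      exact ⟨V, H, hH, ∅, by simp, hV⟩
    obtain ⟨V, ⟨H, hH, q, hq, hV⟩, hmin⟩ := IsArtinian.set_has_minimal 𝒱 h𝒱
    obtain ⟨h, hh⟩ := hsolne H hH q hq
    have key : ∀ H' ∈ 𝓗, ∀ q' : Finset (M × M), ↑q' ⊆ Q → ∃ h' ∈ sol H' q', h' m = h m := by
      intro H' hH' q' hq'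
      obtain ⟨K, hK, hKH, hKH'⟩ := hdir H hH H' hH'
      have hsub : sol K (q ∪ q') ⊆ sol H q := fun k hk =>
        ⟨hKH hk.1, fun p hp => hk.2 p (Finset.mem_union_left _ hp)⟩
      have hsub' : sol K (q ∪ q') ⊆ sol H' q' := fun k hk =>
        ⟨hKH' hk.1, fun p hp => hk.2 p (Finset.mem_union_right _ hp)⟩
      have hqq : ↑(q ∪ q') ⊆ Q := by simpa using ⟨hq, hq'⟩
      obtain ⟨V', hV'⟩ := exists_direction (hsolne K hK _ hqq) (hsol K hK _) m
      have hle : V' ≤ V := fun v hv => by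
        obtain ⟨k, hk, k', hk', rfl⟩ := (hV' v).1 hv
        exact (hV _).2 ⟨k, hsub hk, k', hsub hk', rfl⟩
      have heq : V' = V := by
        by_contra hne'
        exact hmin V' ⟨K, hK, _, hqq, hV'⟩ (lt_of_le_of_ne hle hne')
      obtain ⟨k, hk⟩ := hsolne K hK _ hqq
      have hmem : h m - k m ∈ V' := heq ▸ (hV _).2 ⟨h, hh, k, hsub hk, rfl⟩
      obtain ⟨l, hl, l', hl', hll⟩ := (hV' _).1 hmem
      refine ⟨k + 1 * (l - l'), hsub' (hsol K hK _ k hk l hl l' hl' 1), ?_⟩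
      simp [← hll]
    refine ⟨h m, hQ.le_of_ge (y := insert (m, h m) Q) ?_ (Set.subset_insert _ _)
      (Set.mem_insert _ _)⟩
    intro H' hH' q' hq'
    obtain ⟨h', hh', he⟩ := key H' hH' (q'.erase (m, h m)) fun p hp => by
      have := Finset.mem_erase.1 (Finset.mem_coe.1 hp)
      exact (hq' this.2).resolve_left this.1
    refine ⟨h', hh'.1, fun p hp => ?_⟩
    by_cases hpm : p = (m, h m)
    · rw [hpm, he]
    · exact hh'.2 p (Finset.mem_erase.2 ⟨hpm, hp⟩)
  choose g hg using htotal
  have happrox : ∀ H ∈ 𝓗, ∀ F : Finset M, ∃ h ∈ H, ∀ m ∈ F, h m = g m := by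
    intro H hH F
    obtain ⟨h, hh, hF⟩ := hQ.prop H hH (F.image fun m => (m, g m)) (by
      intro p hp
      obtain ⟨m, -, rfl⟩ := Finset.mem_image.1 (Finset.mem_coe.1 hp)
      exact hg m)
    exact ⟨h, hh, fun m hm => hF _ (Finset.mem_image_of_mem _ hm)⟩
  obtain ⟨H₀, hH₀⟩ := h𝓗
  let g' : Module.End R M :=
    { toFun := g
      map_add' := fun x y => by
        obtain ⟨h, -, hh⟩ := happrox H₀ hH₀ {x, y, x + y}
        rw [← hh x (by simp), ← hh y (by simp), ← hh (x + y) (by simp), map_add]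
      map_smul' := fun r x => by
        obtain ⟨h, -, hh⟩ := happrox H₀ hH₀ {x, r • x}
        rw [← hh x (by simp), ← hh (r • x) (by simp), map_smul, RingHom.id_apply] }
  exact ⟨g', fun H hH => (hcl H hH).mem_of_approx g' (happrox H hH)⟩

theorem IsClosedAffine.sInter {𝓗 : Set (Set (Module.End R M))}
    (h : ∀ H ∈ 𝓗, IsClosedAffine H) : IsClosedAffine (⋂₀ 𝓗) where
  mem_of_approx g hg H hH := (h H hH).mem_of_approx g fun F => by
    obtain ⟨k, hk, hkF⟩ := hg F
    exact ⟨k, hk H hH, hkF⟩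
  affine h₁ hh₁ h₂ hh₂ h₃ hh₃ s H hH :=
    (h H hH).affine _ (hh₁ H hH) _ (hh₂ H hH) _ (hh₃ H hH) s

theorem isClosedAffine_setOf_apply_eq (a b : M) :
    IsClosedAffine {g : Module.End R M | g a = b} where
  mem_of_approx g hg := by
    obtain ⟨h, hh, hF⟩ := hg {a}
    exact (hF a (by simp)).symm.trans hh
  affine h₁ hh₁ h₂ hh₂ h₃ hh₃ s := by simp_all

theorem IsClosedAffine.inter {H K : Set (Module.End R M)} (hH : IsClosedAffine H)
    (hK : IsClosedAffine K) : IsClosedAffine (H ∩ K) := by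
  rw [← Set.sInter_pair]
  exact .sInter (by rintro _ (rfl | rfl) <;> assumption)

/-- Approximability of `g` says that the conditions `h (f m) = g m` are finitely solvable in `H`;
linear compactness solves them all at once. -/
theorem IsClosedAffine.image_mul_right [IsArtinian (Module.End R M) M]
    {H : Set (Module.End R M)} (hH : IsClosedAffine H) (f : Module.End R M) :
    IsClosedAffine ((· * f) '' H) where
  mem_of_approx g hg := by
    classical
    let A (F : Finset M) : Set (Module.End R M) := {h ∈ H | ∀ m ∈ F, h (f m) = g m}
    have hA : ∀ F, IsClosedAffine (A F) := fun F => by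
      have : A F = ⋂₀ insert H ((fun m => {h : Module.End R M | h (f m) = g m}) '' F) := by
        ext h
        simp [A]
      rw [this]
      refine .sInter ?_
      rintro _ (rfl | ⟨m, -, rfl⟩)
      · exact hH
      · exact isClosedAffine_setOf_apply_eq _ _
    obtain ⟨h, hh⟩ := nonempty_sInter_of_isClosedAffine (𝓗 := Set.range A) (Set.range_nonempty _)
      (by
        rintro _ ⟨F, rfl⟩ _ ⟨F', rfl⟩
        exact ⟨_, ⟨F ∪ F', rfl⟩,
          fun h hh => ⟨hh.1, fun m hm => hh.2 m (Finset.mem_union_left _ hm)⟩,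
          fun h hh => ⟨hh.1, fun m hm => hh.2 m (Finset.mem_union_right _ hm)⟩⟩)
      (by rintro _ ⟨F, rfl⟩; exact hA F)
      (by
        rintro _ ⟨F, rfl⟩
        obtain ⟨_, ⟨h, hh, rfl⟩, hF⟩ := hg F
        exact ⟨h, hh, hF⟩)
    have hmem : ∀ F, h ∈ A F := fun F => hh _ ⟨F, rfl⟩
    exact ⟨h, (hmem ∅).1, LinearMap.ext fun m => (hmem {m}).2 m (by simp)⟩
  affine := by
    rintro _ ⟨h₁, hh₁, rfl⟩ _ ⟨h₂, hh₂, rfl⟩ _ ⟨h₃, hh₃, rfl⟩ s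
    refine ⟨_, hH.affine h₁ hh₁ h₂ hh₂ h₃ hh₃ s, ?_⟩
    simp [add_mul, sub_mul, mul_sub, mul_assoc]

/-- The analogue of the Ellis–Numakura lemma for closed affine semigroups of endomorphisms. -/
theorem IsClosedAffine.exists_isIdempotentElem [IsArtinian (Module.End R M) M]
    {H₀ : Set (Module.End R M)} (hne₀ : H₀.Nonempty) (hH₀ : IsClosedAffine H₀)
    (hmul₀ : ∀ x ∈ H₀, ∀ y ∈ H₀, x * y ∈ H₀) : ∃ e ∈ H₀, IsIdempotentElem e := by
  let P : Set (Set (Module.End R M)) :=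
    {H | H.Nonempty ∧ IsClosedAffine H ∧ ∀ x ∈ H, ∀ y ∈ H, x * y ∈ H}
  obtain ⟨H, hHH₀, hmin⟩ := zorn_superset_nonempty P (fun c hc hchain hcne =>
    ⟨⋂₀ c, ⟨nonempty_sInter_of_isClosedAffine hcne
        (fun K hK L hL => (hchain.total hK hL).elim (fun h => ⟨K, hK, subset_rfl, h⟩)
          fun h => ⟨L, hL, h, subset_rfl⟩)
        (fun K hK => (hc hK).2.1) (fun K hK => (hc hK).1),
      .sInter fun K hK => (hc hK).2.1,
      fun x hx y hy K hK => (hc hK).2.2 x (hx K hK) y (hy K hK)⟩,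
      fun K hK => Set.sInter_subset_of_mem hK⟩) H₀ ⟨hne₀, hH₀, hmul₀⟩
  obtain ⟨⟨h, hh⟩, hcl, hmul⟩ := hmin.prop
  -- Minimality gives `H * h = H`, so some `x ∈ H` has `x * h = h`; minimality again makes every
  -- element of `H` such an `x`, in particular `h`.
  have himage : H ⊆ (· * h) '' H := by
    refine hmin.le_of_le ⟨⟨_, h, hh, rfl⟩, hcl.image_mul_right h, ?_⟩ ?_
    · rintro _ ⟨x, hx, rfl⟩ _ ⟨y, hy, rfl⟩
      exact ⟨x * h * y, hmul _ (hmul _ hx _ hh) _ hy, by simp [mul_assoc]⟩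
    · rintro _ ⟨x, hx, rfl⟩
      exact hmul _ hx _ hh
  have hfix : H ⊆ {x ∈ H | x * h = h} := by
    refine hmin.le_of_le ⟨?_, ?_, ?_⟩ (Set.sep_subset _ _)
    · obtain ⟨x, hx, hxh⟩ := himage hh
      exact ⟨x, hx, hxh⟩
    · have : {x ∈ H | x * h = h} =
          H ∩ ⋂₀ Set.range fun m => {x : Module.End R M | x (h m) = h m} := by
        ext x
        simp [LinearMap.ext_iff]
      rw [this]
      refine hcl.inter (.sInter ?_)
      rintro _ ⟨m, rfl⟩
      exact isClosedAffine_setOf_apply_eq _ _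
    · exact fun x hx y hy => ⟨hmul _ hx.1 _ hy.1, by rw [mul_assoc, hy.2, hx.2]⟩
  exact ⟨h, hHH₀ hh, (hfix hh).2⟩

/-- The maps `g * f` with `g a = a` form a closed affine semigroup. Its idempotent fixes `a ≠ 0`, so
it is `1` and `f` is split injective. -/
theorem IsIndecomposable.isUnit_of_apply_eq_self [IsArtinian (Module.End R M) M]
    (hM : IsIndecomposable R M) {f : Module.End R M} {a : M} (ha : a ≠ 0) (hfa : f a = a) :
    IsUnit f := by
  obtain ⟨e, ⟨g, hg, hge⟩, he⟩ := IsClosedAffine.exists_isIdempotentElem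
    (H₀ := (· * f) '' {g : Module.End R M | g a = a}) ⟨_, 1, rfl, rfl⟩
    ((isClosedAffine_setOf_apply_eq a a).image_mul_right f) (by
      rintro _ ⟨x, hx, rfl⟩ _ ⟨y, hy, rfl⟩
      exact ⟨x * f * y, by simp_all, by simp [mul_assoc]⟩)
  have := hM.1
  have hea : e a = a := by
    rw [← hge]
    simpa [hfa] using hg
  rcases hM.eq_zero_or_eq_one he with rfl | rfl
  · exact absurd hea.symm ha
  · exact (Module.End.isUnit_iff f).2 (hM.bijective_of_comp_eq_id hge)

/-- An indecomposable module which is artinian over its endomorphism ring has a local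
endomorphism ring. -/
theorem IsIndecomposable.isUnit_or_isUnit_one_sub [IsArtinian (Module.End R M) M]
    (hM : IsIndecomposable R M) (f : Module.End R M) : IsUnit f ∨ IsUnit (1 - f) := by
  have := hM.1
  obtain ⟨U, hU⟩ := IsAtomic.exists_atom (Submodule (Module.End R M) M)
  obtain ⟨a, haU, ha⟩ := Submodule.exists_mem_ne_zero_of_ne_bot hU.1
  by_cases hfa : f a = 0
  · exact .inr (hM.isUnit_of_apply_eq_self ha (by simp [hfa]))
  · left
    -- Simplicity of `U` recovers `a` from `f a`, so some `g * f` fixes `a`.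
    have hspan : a ∈ Submodule.span (Module.End R M) {f a} := by
      rcases hU.le_iff.1 (Submodule.span_le.2 (Set.singleton_subset_iff.2 (U.smul_mem f haU)))
        with h | h
      · exact absurd (Submodule.span_singleton_eq_bot.1 h) hfa
      · exact h ▸ haU
    obtain ⟨g, hg⟩ := Submodule.mem_span_singleton.1 hspan
    have hgf := (Module.End.isUnit_iff _).1 (hM.isUnit_of_apply_eq_self (f := g * f) ha hg)
    exact (Module.End.isUnit_iff f).2 (hM.bijective_of_bijective_comp hgf).1

end LinearCompactness

/-! ### The Jacobson radical of endomorphism rings. -/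

section Jacobson

/-- The chain stabilises, and Nakayama's lemma kills the stable term. -/
theorem exists_pow_jacobson_smul_top_eq_bot (S N : Type*) [Ring S] [AddCommGroup N] [Module S N]
    [IsNoetherian S N] [IsArtinian S N] :
    ∃ n : ℕ, Ring.jacobson S ^ n • (⊤ : Submodule S N) = ⊥ := by
  obtain ⟨n, hn⟩ := IsArtinian.monotone_stabilizes
    (⟨fun n => OrderDual.toDual (Ring.jacobson S ^ n • (⊤ : Submodule S N)),
      monotone_nat_of_le_succ fun n => by
        rw [OrderDual.toDual_le_toDual, Ideal.IsTwoSided.pow_succ, Submodule.mul_smul]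
        exact Submodule.smul_le_right⟩ : ℕ →o (Submodule S N)ᵒᵈ)
  refine ⟨n, (IsNoetherian.noetherian _).eq_bot_of_le_jacobson_smul ?_⟩
  rw [← Submodule.mul_smul, ← Ideal.IsTwoSided.pow_succ]
  exact (OrderDual.toDual.injective (hn (n + 1) n.le_succ)).le

theorem mem_jacobson_of_forall_exists {S : Type*} [Ring S] {x : S}
    (h : ∀ y, ∃ z, z * (1 + y * x) = 1) : x ∈ Ring.jacobson S := by
  rw [← Ideal.jacobson_bot, Ideal.mem_jacobson_iff]
  intro y
  obtain ⟨z, hz⟩ := h y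
  exact ⟨z, by rw [Ideal.mem_bot, ← hz]; noncomm_ring⟩

theorem exists_mul_eq_one_of_mem_jacobson {S : Type*} [Ring S] {x : S}
    (h : x ∈ Ring.jacobson S) (y : S) : ∃ z, z * (1 + y * x) = 1 := by
  rw [← Ideal.jacobson_bot, Ideal.mem_jacobson_iff] at h
  obtain ⟨z, hz⟩ := h y
  refine ⟨z, ?_⟩
  rw [← sub_eq_zero, ← Ideal.mem_bot.1 hz]
  noncomm_ring

variable {R : Type*} [Ring R]

theorem not_bijective_of_mem_jacobson_end {N : Type*} [AddCommGroup N] [Module R N] [Nontrivial N]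
    {f : Module.End R N} (hf : f ∈ Ring.jacobson (Module.End R N)) : ¬ Function.Bijective f :=
  fun h => (Ring.jacobson_lt_top (Module.End R N)).ne
    (Ideal.eq_top_of_isUnit_mem _ hf ((Module.End.isUnit_iff f).2 h))

theorem IsIndecomposable.mem_jacobson_end {N : Type*} [AddCommGroup N] [Module R N]
    (hN : IsIndecomposable R N) (hloc : ∀ f : Module.End R N, IsUnit f ∨ IsUnit (1 - f))
    {f : Module.End R N} (hf : ¬ Function.Bijective f) : f ∈ Ring.jacobson (Module.End R N) := by
  have := hN.1
  refine mem_jacobson_of_forall_exists fun y => ?_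
  rcases hloc (-y * f) with h | h
  · exact absurd (hN.bijective_of_bijective_comp ((Module.End.isUnit_iff _).1 h)).1 hf
  · obtain ⟨z, hz⟩ := h.exists_left_inv
    exact ⟨z, (by noncomm_ring : z * (1 + y * f) = z * (1 - -y * f)).trans hz⟩

theorem IsIndecomposable.isSemisimpleRing_end_quotient {N : Type*} [AddCommGroup N] [Module R N]
    (hN : IsIndecomposable R N) (hloc : ∀ f : Module.End R N, IsUnit f ∨ IsUnit (1 - f)) :
    IsSemisimpleRing (Module.End R N ⧸ Ring.jacobson (Module.End R N)) := by
  have := hN.1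
  have : IsSimpleModule (Module.End R N ⧸ Ring.jacobson (Module.End R N))
      (Module.End R N ⧸ Ring.jacobson (Module.End R N)) := by
    refine isSimpleModule_self_iff_isUnit.2
      ⟨Ideal.Quotient.nontrivial_iff.2 (Ring.jacobson_lt_top _).ne, fun x hx => ?_⟩
    obtain ⟨f, rfl⟩ := Ideal.Quotient.mk_surjective x
    have hf : IsUnit f := by
      rw [Module.End.isUnit_iff]
      by_contra h
      exact hx (Ideal.Quotient.eq_zero_iff_mem.2 (hN.mem_jacobson_end hloc h))
    exact hf.map _
  infer_instance

variable {I : Type*} [DecidableEq I] {M : I → Type*} [∀ i, AddCommGroup (M i)]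
  [∀ i, Module R (M i)]

/-- If `v` is a left inverse of `1 + b a` then `1 - a v b` is one of `1 + a b`; so the question
moves to the local ring `End (M i)`, where `b a` factors through the non-isomorphism `f`. -/
theorem lof_comp_component_mem_jacobson {i j : I} (hi : Nontrivial (M i))
    (hj : IsIndecomposable R (M j))
    (hloc : ∀ f : Module.End R (M i), IsUnit f ∨ IsUnit (1 - f)) {f : M i →ₗ[R] M j}
    (hf : ¬ Function.Bijective f) :
    (DirectSum.lof R I M j ∘ₗ f ∘ₗ DirectSum.component R I M i : Module.End R (⨁ i, M i)) ∈
      Ring.jacobson (Module.End R (⨁ i, M i)) := by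
  refine mem_jacobson_of_forall_exists fun y => ?_
  let a : M i →ₗ[R] ⨁ i, M i := y ∘ₗ DirectSum.lof R I M j ∘ₗ f
  let b : (⨁ i, M i) →ₗ[R] M i := DirectSum.component R I M i
  rcases hloc ((-(b ∘ₗ y ∘ₗ DirectSum.lof R I M j)) ∘ₗ f) with h | h
  · exact absurd (hj.bijective_of_bijective_comp ((Module.End.isUnit_iff _).1 h)).1 hf
  · obtain ⟨v, hv⟩ := h.exists_left_inv
    have hv' : ∀ x, v x + v (b (a x)) = x := fun x => by
      simpa [a, sub_neg_eq_add] using congrArg (fun k : Module.End R (M i) => k x) hv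
    refine ⟨1 - a ∘ₗ v ∘ₗ b, LinearMap.ext fun x => ?_⟩
    have h1 : (y * (DirectSum.lof R I M j ∘ₗ f ∘ₗ DirectSum.component R I M i)) x = a (b x) := rfl
    have h2 := congrArg a (hv' (b x))
    rw [map_add] at h2
    rw [Module.End.mul_apply, LinearMap.add_apply, h1, LinearMap.sub_apply]
    simp only [Module.End.one_apply, LinearMap.comp_apply, map_add]
    rw [h2]
    abel

/-- An inverse of the composite provides `y` such that the left invertible `1 + y * s` kills the
copy of `M i`. -/
theorem not_bijective_of_mem_jacobson {i : I} (hi : Nontrivial (M i))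
    {s : Module.End R (⨁ i, M i)} (hs : s ∈ Ring.jacobson (Module.End R (⨁ i, M i)))
    {N : Type*} [AddCommGroup N] [Module R N] (g : (⨁ i, M i) →ₗ[R] N) :
    ¬ Function.Bijective (g ∘ₗ s ∘ₗ DirectSum.lof R I M i) := by
  intro h
  let e := LinearEquiv.ofBijective _ h
  have he : ∀ x, e.symm (g (s (DirectSum.lof R I M i x))) = x := e.symm_apply_apply
  obtain ⟨z, hz⟩ := exists_mul_eq_one_of_mem_jacobson hs
    (-(DirectSum.lof R I M i ∘ₗ e.symm.toLinearMap ∘ₗ g))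
  obtain ⟨x, hx⟩ := exists_ne (0 : M i)
  have := congrArg (fun k : Module.End R (⨁ i, M i) => k (DirectSum.lof R I M i x)) hz
  simp only [Module.End.mul_apply, LinearMap.add_apply, Module.End.one_apply, LinearMap.neg_apply,
    LinearMap.comp_apply, LinearEquiv.coe_coe, he, add_neg_cancel, map_zero] at this
  exact hx (by simpa using congrArg (DirectSum.component R I M i) this.symm)

end Jacobson

/-! ### Reduction to the transversal; (2) implies (1). -/

section Transversal

variable {R : Type*} [Ring R] {I : Type*} {M : I → Type*} [∀ i, AddCommGroup (M i)]
  [∀ i, Module R (M i)] {T : Set I}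

theorem IsTransversal.eq_of_bijective (hT : IsTransversal R M T) {s t : I} (hs : s ∈ T)
    (ht : t ∈ T) {f : M s →ₗ[R] M t} (hf : Function.Bijective f) : s = t :=
  (hT s).unique ⟨hs, ⟨LinearEquiv.refl R _⟩⟩ ⟨ht, ⟨LinearEquiv.ofBijective f hf⟩⟩

theorem IsTransversal.exists_lof_notMem [DecidableEq I] (hT : IsTransversal R M T)
    {W : Submodule (Module.End R (⨁ i, M i)) (⨁ i, M i)} {x : ⨁ i, M i} (hx : x ∉ W) :
    ∃ t ∈ T, ∃ g : (⨁ i, M i) →ₗ[R] M t, DirectSum.lof R I M t (g x) ∉ W := by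
  obtain ⟨i, hi⟩ := EndoStructure.exists_lof_notMem hx
  obtain ⟨t, ⟨ht, ⟨φ⟩⟩, -⟩ := hT i
  refine ⟨t, ht, φ.toLinearMap ∘ₗ DirectSum.component R I M i, fun h => hi ?_⟩
  simpa using! lof_map_mem W h φ.symm.toLinearMap

theorem IsTransversal.le_of_homogeneousPart_le [DecidableEq I] (hT : IsTransversal R M T)
    {W W' : Submodule (Module.End R (⨁ i, M i)) (⨁ i, M i)}
    (h : ∀ t ∈ T, homogeneousPart W t ≤ homogeneousPart W' t) : W ≤ W' := by
  intro x hx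
  by_contra hx'
  obtain ⟨t, ht, g, hg⟩ := hT.exists_lof_notMem hx'
  exact hg (h t ht (lof_apply_mem W hx g))

/-- Fully invariant submodules of the direct sum, embedded into families of submodules of the
members of a transversal. -/
noncomputable def IsTransversal.homogeneousParts [DecidableEq I] (hT : IsTransversal R M T) :
    Submodule (Module.End R (⨁ i, M i)) (⨁ i, M i) ↪o
      (∀ t : T, Submodule (Module.End R (M t)) (M t)) :=
  OrderEmbedding.ofMapLEIff (fun W t => homogeneousPart W t) fun _ _ =>
    ⟨fun h => hT.le_of_homogeneousPart_le fun t ht => h ⟨t, ht⟩, fun h _ _ hx => h hx⟩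

theorem IsTransversal.isNoetherian_directSum (hT : IsTransversal R M T) (hfin : T.Finite)
    (h : ∀ t ∈ T, IsNoetherian (Module.End R (M t)) (M t)) :
    IsNoetherian (Module.End R (⨁ i, M i)) (⨁ i, M i) := by
  classical
  have := hfin.to_subtype
  have : ∀ t : T, WellFoundedGT (Submodule (Module.End R (M t)) (M t)) := fun t =>
    isNoetherian_iff'.1 (h t t.2)
  let F (W : Submodule (Module.End R (⨁ i, M i)) (⨁ i, M i)) (t : T) :
    (Submodule (Module.End R (M t)) (M t))ᵒᵈ := OrderDual.toDual (hT.homogeneousParts W t)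
  have hF : StrictAnti F := fun _ _ h => hT.homogeneousParts.strictMono h
  exact isNoetherian_iff'.2 hF.wellFoundedGT

theorem IsTransversal.isArtinian_directSum (hT : IsTransversal R M T) (hfin : T.Finite)
    (h : ∀ t ∈ T, IsArtinian (Module.End R (M t)) (M t)) :
    IsArtinian (Module.End R (⨁ i, M i)) (⨁ i, M i) := by
  classical
  have := hfin.to_subtype
  have : ∀ t : T, WellFoundedLT (Submodule (Module.End R (M t)) (M t)) := fun t => h t t.2
  exact hT.homogeneousParts.strictMono.wellFoundedLT

/-- Each map in the sequence contributes a factor from the radical, a power of which annihilates the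
sum; one length serves all sequences. -/
theorem IsTransversal.isRightTNilpotent (hM : ∀ i, IsIndecomposable R (M i))
    (hT : IsTransversal R M T) (hfin : T.Finite) (h : ∀ t ∈ T, IsEndofinite R (M t)) :
    IsRightTNilpotent R (fun t : T => M t) := by
  classical
  have h' := fun t ht => isFiniteLength_iff_isNoetherian_isArtinian.1 (h t ht)
  have := hT.isNoetherian_directSum hfin fun t ht => (h' t ht).1
  have := hT.isArtinian_directSum hfin fun t ht => (h' t ht).2
  obtain ⟨n, hn⟩ := exists_pow_jacobson_smul_top_eq_bot (Module.End R (⨁ i, M i)) (⨁ i, M i)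
  intro i f hf X _
  have key : ∀ n x, DirectSum.lof R I M (i n) (forwardComp (M := fun t : T => M t) i f n x) ∈
      Ring.jacobson (Module.End R (⨁ i, M i)) ^ n •
        (⊤ : Submodule (Module.End R (⨁ i, M i)) (⨁ i, M i)) := by
    intro n x
    induction n with
    | zero =>
      rw [Submodule.pow_zero, Ideal.one_eq_top, Submodule.top_smul]
      trivial
    | succ n ih =>
      have := (h' (i n) (i n).2).2
      rw [Ideal.IsTwoSided.pow_succ, Submodule.mul_smul]
      have hmem := Submodule.smul_mem_smul (lof_comp_component_mem_jacobson (hM (i n)).1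
        (hM (i (n + 1))) (hM (i n)).isUnit_or_isUnit_one_sub (hf n)) ih
      rwa [Module.End.smul_def, LinearMap.comp_apply, LinearMap.comp_apply,
        DirectSum.component.lof_self] at hmem
  refine ⟨n, (Submodule.eq_bot_iff _).2 ?_⟩
  rintro _ ⟨x, -, rfl⟩
  have hx := key n x
  rw [hn, Submodule.mem_bot] at hx
  simpa using congrArg (DirectSum.component R I M (i n)) hx

end Transversal

/-! ### Loewy series; (1) implies (2). -/

section Loewy

/-- The `n`-th term of the ascending Loewy series with respect to the Jacobson radical: the
elements annihilated by every product of `n` elements of the radical. -/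
def loewy (S N : Type*) [Ring S] [AddCommGroup N] [Module S N] : ℕ → Submodule S N
  | 0 => ⊥
  | n + 1 =>
    { carrier := {x | ∀ s ∈ Ring.jacobson S, s • x ∈ loewy S N n}
      add_mem' := fun hx hy s hs => by simpa using add_mem (hx s hs) (hy s hs)
      zero_mem' := fun s _ => by simp
      smul_mem' := fun r x hx s hs => by
        simpa [mul_smul] using hx (s * r) (Ideal.mul_mem_right r _ hs) }

variable {S N : Type*} [Ring S] [AddCommGroup N] [Module S N]

theorem loewy_mono : Monotone (loewy S N) := by
  refine monotone_nat_of_le_succ fun n => ?_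
  induction n with
  | zero => exact bot_le
  | succ n ih => exact fun x hx s hs => ih (hx s hs)

theorem exists_loewy_eq_loewy_succ [IsNoetherian S N] : ∃ n, loewy S N n = loewy S N (n + 1) := by
  obtain ⟨n, hn⟩ := monotone_stabilizes_iff_noetherian.2 ‹_› ⟨loewy S N, loewy_mono⟩
  exact ⟨n, hn (n + 1) n.le_succ⟩

end Loewy

variable {R : Type*} [Ring R]

/-- The members of a right T-nilpotent family have local endomorphism rings. -/
theorem IsRightTNilpotent.isUnit_or_isUnit_one_sub {T : Type*} {M : T → Type*}
    [∀ i, AddCommGroup (M i)] [∀ i, Module R (M i)] (h : IsRightTNilpotent R M) (t : T)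
    (f : Module.End R (M t)) : IsUnit f ∨ IsUnit (1 - f) := by
  by_cases hf : Function.Bijective f
  · exact .inl ((Module.End.isUnit_iff f).2 hf)
  right
  have hcomp : ∀ n, forwardComp (M := M) (fun _ => t) (fun _ => f) n = f ^ n := by
    intro n
    induction n with
    | zero => rfl
    | succ n ih => rw [pow_succ', ← ih]; rfl
  -- The constant sequence makes `f` pointwise nilpotent: `1 - f` is then injective, and truncated
  -- geometric series make it surjective.
  have hnil : ∀ x, ∃ n, (f ^ n) x = 0 := fun x => by
    obtain ⟨n, hn⟩ := h (fun _ => t) (fun _ => f) (fun _ => hf) (Submodule.span R {x})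
      (Submodule.fg_span_singleton x)
    rw [hcomp] at hn
    exact ⟨n, (Submodule.eq_bot_iff _).1 hn _
      (Submodule.mem_map_of_mem (Submodule.mem_span_singleton_self x))⟩
  refine (Module.End.isUnit_iff _).2 ⟨?_, fun x => ?_⟩
  · refine (injective_iff_map_eq_zero _).2 fun x hx => ?_
    have hfx : f x = x := (sub_eq_zero.1 hx).symm
    obtain ⟨n, hn⟩ := hnil x
    rwa [Module.End.pow_apply, Function.iterate_fixed hfx] at hn
  · obtain ⟨n, hn⟩ := hnil x
    refine ⟨(∑ i ∈ Finset.range n, f ^ i) x, ?_⟩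
    rw [← Module.End.mul_apply, mul_neg_geom_sum]
    simp [hn]

variable {I : Type*} {M : I → Type*} [∀ i, AddCommGroup (M i)] [∀ i, Module R (M i)] {T : Set I}

/-- The radical moves an element outside `W` to another one outside `W`; projected to the
transversal, each move is a non-isomorphism. Iterating gives composites that never kill the starting
element. -/
theorem IsTransversal.eq_top_of_isRightTNilpotent [DecidableEq I]
    (hM : ∀ i, IsIndecomposable R (M i)) (hT : IsTransversal R M T)
    (hnil : IsRightTNilpotent R (fun t : T => M t))
    {W : Submodule (Module.End R (⨁ i, M i)) (⨁ i, M i)}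
    (hW : ∀ x, (∀ s ∈ Ring.jacobson (Module.End R (⨁ i, M i)), s • x ∈ W) → x ∈ W) : W = ⊤ := by
  by_contra hne
  obtain ⟨x, -, hx⟩ := SetLike.exists_of_lt (lt_top_iff_ne_top.2 hne)
  obtain ⟨t, ht, g, hg⟩ := hT.exists_lof_notMem hx
  have step : ∀ p : {p : Σ t : T, M t // DirectSum.lof R I M p.1 p.2 ∉ W},
      ∃ q : {p : Σ t : T, M t // DirectSum.lof R I M p.1 p.2 ∉ W},
        ∃ f : M p.1.1 →ₗ[R] M q.1.1, ¬ Function.Bijective f ∧ f p.1.2 = q.1.2 := by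
    rintro ⟨⟨t, x⟩, hx⟩
    obtain ⟨s, hs, hsx⟩ : ∃ s ∈ Ring.jacobson (Module.End R (⨁ i, M i)),
        s • DirectSum.lof R I M t x ∉ W := by simpa using mt (hW _) hx
    obtain ⟨u, hu, k, hk⟩ := hT.exists_lof_notMem hsx
    exact ⟨⟨⟨⟨u, hu⟩, _⟩, hk⟩, k ∘ₗ s ∘ₗ DirectSum.lof R I M t,
      not_bijective_of_mem_jacobson (hM t).1 hs k, rfl⟩
  choose next f hf hfx using step
  let p : ℕ → {p : Σ t : T, M t // DirectSum.lof R I M p.1 p.2 ∉ W} :=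
    fun n => Nat.rec ⟨⟨⟨t, ht⟩, g x⟩, hg⟩ (fun _ => next) n
  have hcomp : ∀ n, forwardComp (M := fun t : T => M t) (fun n => (p n).1.1)
      (fun n => f (p n)) n (p 0).1.2 = (p n).1.2 := by
    intro n
    induction n with
    | zero => rfl
    | succ n ih =>
      change f (p n) (forwardComp (M := fun t : T => M t) (fun n => (p n).1.1)
        (fun n => f (p n)) n (p 0).1.2) = _
      rw [ih]
      exact hfx (p n)
  obtain ⟨n, hn⟩ := hnil (fun n => (p n).1.1) (fun n => f (p n)) (fun n => hf (p n))
    (Submodule.span R {(p 0).1.2}) (Submodule.fg_span_singleton _)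
  have h0 : (p n).1.2 = 0 := (hcomp n).symm.trans ((Submodule.eq_bot_iff _).1 hn _
      (Submodule.mem_map_of_mem (Submodule.mem_span_singleton_self _)))
  exact (p n).2 (by rw [h0, map_zero]; exact W.zero_mem)

/-- In each layer of the Loewy series of an endo-noetherian direct sum, only finitely many
members of the transversal are involved. -/
theorem IsTransversal.finite_loewy_layer [DecidableEq I]
    (hM : ∀ i, IsIndecomposable R (M i)) (hT : IsTransversal R M T)
    (hloc : ∀ t ∈ T, ∀ f : Module.End R (M t), IsUnit f ∨ IsUnit (1 - f))
    [IsNoetherian (Module.End R (⨁ i, M i)) (⨁ i, M i)] (n : ℕ) :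
    {t ∈ T | ∃ x : M t, DirectSum.lof R I M t x ∈ loewy (Module.End R (⨁ i, M i)) _ (n + 1) ∧
      DirectSum.lof R I M t x ∉ loewy (Module.End R (⨁ i, M i)) _ n}.Finite := by
  set A := {t ∈ T | ∃ x : M t, DirectSum.lof R I M t x ∈
    loewy (Module.End R (⨁ i, M i)) _ (n + 1) ∧
      DirectSum.lof R I M t x ∉ loewy (Module.End R (⨁ i, M i)) _ n}
  -- In `W F`, only indices of `T` lying in `F` may contribute modulo the `n`-th term.
  let W (F : Set I) : Submodule (Module.End R (⨁ i, M i)) (⨁ i, M i) :=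
    { carrier := {x | x ∈ loewy (Module.End R (⨁ i, M i)) _ (n + 1) ∧ ∀ t ∈ T, t ∉ F →
        ∀ g : (⨁ i, M i) →ₗ[R] M t,
          DirectSum.lof R I M t (g x) ∈ loewy (Module.End R (⨁ i, M i)) _ n}
      add_mem' := fun hx hy => ⟨add_mem hx.1 hy.1, fun t ht htF g => by
        simpa using add_mem (hx.2 t ht htF g) (hy.2 t ht htF g)⟩
      zero_mem' := ⟨zero_mem _, by simp⟩
      smul_mem' := fun s x hx => ⟨Submodule.smul_mem _ s hx.1,
        fun t ht htF g => hx.2 t ht htF (g ∘ₗ s)⟩ }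
  have hmem : ∀ t ∈ T, ∀ x : M t,
      DirectSum.lof R I M t x ∈ loewy (Module.End R (⨁ i, M i)) _ (n + 1) →
      DirectSum.lof R I M t x ∉ loewy (Module.End R (⨁ i, M i)) _ n →
      ∀ F, DirectSum.lof R I M t x ∈ W F ↔ t ∈ F := by
    intro t ht x hx hx' F
    refine ⟨fun h => by_contra fun htF => hx' ?_, fun htF => ⟨hx, fun u hu huF g => ?_⟩⟩
    · simpa using h.2 t ht htF (DirectSum.component R I M t)
    · have hnb : ¬ Function.Bijective (g ∘ₗ DirectSum.lof R I M t) := fun h =>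
        huF (hT.eq_of_bijective ht hu h ▸ htF)
      simpa using! hx _ (lof_comp_component_mem_jacobson (hM t).1 (hM u) (hloc t ht) hnb)
  -- Infinitely many indices would make `W` strictly increasing along initial segments of an
  -- enumeration.
  by_contra hinf
  let a : ℕ ↪ A := Set.Infinite.natEmbedding A hinf
  have hmono : Monotone fun m => W ((fun k => (a k : I)) '' Set.Iio m) := fun m m' h x hx =>
    ⟨hx.1, fun t ht htF => hx.2 t ht fun h' => htF
      (Set.image_mono (Set.Iio_subset_Iio h) h')⟩
  obtain ⟨m, hm⟩ := monotone_stabilizes_iff_noetherian.2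
    ‹IsNoetherian (Module.End R (⨁ i, M i)) (⨁ i, M i)› ⟨_, hmono⟩
  have heq : W ((fun k => (a k : I)) '' Set.Iio m) = W ((fun k => (a k : I)) '' Set.Iio (m + 1)) :=
    hm (m + 1) m.le_succ
  obtain ⟨hat, x, hx, hx'⟩ := (a m).2
  have h1 := (hmem _ hat x hx hx' ((fun k => (a k : I)) '' Set.Iio (m + 1))).2
    ⟨m, by simp, rfl⟩
  rw [← heq, hmem _ hat x hx hx'] at h1
  obtain ⟨k, hk, hkm⟩ := h1
  exact (ne_of_lt hk) (a.injective (Subtype.ext hkm))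

theorem isNoetherian_of_isEndoNoetherian_directSum
    (h : IsEndoNoetherian R (⨁ i, M i)) (i : I) : IsNoetherian (Module.End R (M i)) (M i) := by
  classical
  have : WellFoundedGT (Submodule (Module.End R (⨁ i, M i)) (⨁ i, M i)) := isNoetherian_iff'.1 h
  have hmono : StrictMono (fullyInvariantHull (R := R) (M := M) i) :=
    strictMono_of_le_iff_le fun _ _ => fullyInvariantHull_le_iff.symm
  exact isNoetherian_iff'.2 hmono.wellFoundedGT

/-- Radical elements of `End (M t)` extend by zero into the radical of the big ring, so their
`n`-fold products vanish. Thus `End (M t)` is semiprimary and Hopkins–Levitzki applies. -/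
theorem isEndofinite_of_loewy_eq_top [DecidableEq I] (hM : ∀ i, IsIndecomposable R (M i))
    (hnoeth : IsEndoNoetherian R (⨁ i, M i)) {n : ℕ}
    (hn : loewy (Module.End R (⨁ i, M i)) (⨁ i, M i) n = ⊤) (t : I)
    (hloc : ∀ f : Module.End R (M t), IsUnit f ∨ IsUnit (1 - f)) : IsEndofinite R (M t) := by
  have hN := isNoetherian_of_isEndoNoetherian_directSum hnoeth t
  have := (hM t).1
  have key : ∀ k, ∀ s ∈ Ring.jacobson (Module.End R (M t)) ^ k, ∀ x : M t,
      DirectSum.lof R I M t x ∈ loewy (Module.End R (⨁ i, M i)) _ k → s x = 0 := by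
    intro k
    induction k with
    | zero =>
      intro s _ x hx
      have hx0 : x = 0 := by
        simpa using congrArg (DirectSum.component R I M t) ((Submodule.mem_bot _).1 hx)
      rw [hx0, map_zero]
    | succ k ih =>
      intro s hs x hx
      rw [Submodule.pow_succ] at hs
      refine Submodule.smul_induction_on hs (fun a ha b hb => ?_) fun a b ha hb => ?_
      · refine ih a ha (b x) ?_
        simpa using! hx _ (lof_comp_component_mem_jacobson (hM t).1 (hM t) hloc
          (not_bijective_of_mem_jacobson_end hb))
      · rw [LinearMap.add_apply, ha, hb, add_zero]
  have hss := (hM t).isSemisimpleRing_end_quotient hloc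
  have hsp : IsSemiprimaryRing (Module.End R (M t)) := by
    refine (isSemiprimaryRing_iff _).2 ⟨hss, n, (Submodule.eq_bot_iff _).2 fun s hs => ?_⟩
    exact LinearMap.ext fun x => key n s hs x (hn ▸ Submodule.mem_top)
  exact isFiniteLength_iff_isNoetherian_isArtinian.2
    ⟨hN, IsSemiprimaryRing.isNoetherian_iff_isArtinian.1 hN⟩

theorem IsTransversal.finite_and_isEndofinite (hM : ∀ i, IsIndecomposable R (M i))
    (hT : IsTransversal R M T) (hnoeth : IsEndoNoetherian R (⨁ i, M i))
    (hnil : IsRightTNilpotent R (fun t : T => M t)) :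
    T.Finite ∧ ∀ t ∈ T, IsEndofinite R (M t) := by
  classical
  have : IsNoetherian (Module.End R (⨁ i, M i)) (⨁ i, M i) := hnoeth
  have hloc : ∀ t ∈ T, ∀ f : Module.End R (M t), IsUnit f ∨ IsUnit (1 - f) :=
    fun t ht => hnil.isUnit_or_isUnit_one_sub ⟨t, ht⟩
  obtain ⟨n, hn⟩ := exists_loewy_eq_loewy_succ (S := Module.End R (⨁ i, M i)) (N := ⨁ i, M i)
  have htop : loewy (Module.End R (⨁ i, M i)) (⨁ i, M i) n = ⊤ :=
    hT.eq_top_of_isRightTNilpotent hM hnil fun x hx => by rwa [hn]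
  refine ⟨?_, fun t ht => isEndofinite_of_loewy_eq_top hM hnoeth htop t (hloc t ht)⟩
  refine ((Set.finite_Iio n).biUnion fun k _ => hT.finite_loewy_layer hM hloc k).subset
    fun t ht => ?_
  have := (hM t).1
  obtain ⟨x, hx⟩ := exists_ne (0 : M t)
  -- The least such `k` is positive because the zeroth term is zero; hence `x` lies in a genuine
  -- layer.
  have hex : ∃ k, DirectSum.lof R I M t x ∈ loewy (Module.End R (⨁ i, M i)) _ k :=
    ⟨n, htop ▸ Submodule.mem_top⟩
  obtain ⟨k, hk⟩ : ∃ k, Nat.find hex = k + 1 := Nat.exists_eq_succ_of_ne_zero fun h0 => by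
    have h := Nat.find_spec hex
    rw [h0] at h
    exact hx (by simpa using congrArg (DirectSum.component R I M t) ((Submodule.mem_bot _).1 h))
  have hspec := Nat.find_spec hex
  rw [hk] at hspec
  have hle : Nat.find hex ≤ n := Nat.find_min' hex (htop ▸ Submodule.mem_top)
  exact Set.mem_biUnion (show k < n by omega)
    ⟨ht, x, hspec, Nat.find_min hex (by omega)⟩

universe u v

/-! ### Chain conditions from Σ-algebraic compactness. -/

section AlgebraicallyCompact

variable {R : Type u} [Ring R] {N : Type v} [AddCommGroup N] [Module R N]

theorem IsAlgebraicallyCompact.exists_solution {A : Type max u v} [AddCommGroup A] [Module R A]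
    (h : IsAlgebraicallyCompact R A) {I : Type max u v} {J : Type v} (a : I → J →₀ R) (b : I → A)
    (hfin : ∀ F : Finset I, ∃ x : J → A, ∀ i ∈ F, Finsupp.linearCombination R x (a i) = b i) :
    ∃ x : J → A, ∀ i, Finsupp.linearCombination R x (a i) = b i := by
  have hsum : ∀ (x : ULift.{u} J → A) i,
      (((a i).mapDomain ULift.up).sum fun j r => r • x j) =
        Finsupp.linearCombination R (x ∘ ULift.up) (a i) := fun x i => by
    rw [← Finsupp.linearCombination_apply, Finsupp.linearCombination_mapDomain]
  obtain ⟨x, hx⟩ := h I (ULift.{u} J) (fun i => (a i).mapDomain ULift.up) b fun F => by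
    obtain ⟨x, hx⟩ := hfin F
    exact ⟨x ∘ ULift.down, fun i hi => (hsum _ i).trans (hx i hi)⟩
  exact ⟨x ∘ ULift.up, fun i => (hsum x i).symm.trans (hx i)⟩

variable (R N) in
/-- The coefficients of the equations in unknowns indexed by `N` expressing that a map on `N`
is `R`-linear. -/
noncomputable def linearityEquation : (N × N) ⊕ (R × N) → N →₀ R
  | .inl (m, m') => Finsupp.single (m + m') 1 - Finsupp.single m 1 - Finsupp.single m' 1
  | .inr (r, m) => Finsupp.single (r • m) 1 - Finsupp.single m r

theorem linearCombination_linearityEquation {A : Type*} [AddCommGroup A] [Module R A]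
    (f : N →ₗ[R] A) (e : (N × N) ⊕ (R × N)) :
    Finsupp.linearCombination R f (linearityEquation R N e) = 0 := by
  rcases e with ⟨m, m'⟩ | ⟨r, m⟩ <;> simp [linearityEquation]

/-- A solution of the linearity equations is a linear map. -/
def linearMapOfLinearityEquation {A : Type*} [AddCommGroup A] [Module R A] (f : N → A)
    (hf : ∀ e, Finsupp.linearCombination R f (linearityEquation R N e) = 0) : N →ₗ[R] A where
  toFun := f
  map_add' m m' := by
    have := hf (.inl (m, m'))
    simp only [linearityEquation, map_sub, Finsupp.linearCombination_single, one_smul] at this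
    rwa [sub_sub, sub_eq_zero] at this
  map_smul' r m := by
    have := hf (.inr (r, m))
    simp only [linearityEquation, map_sub, Finsupp.linearCombination_single, one_smul] at this
    rwa [sub_eq_zero] at this

/-- An endomorphism sending `x` to `y` is a solution of a linear system whose unknowns are its
values. The system is solved in a sum of copies of `N` and projected to one coordinate. -/
theorem IsSigmaAlgebraicallyCompact.mem_span_singleton (h : IsSigmaAlgebraicallyCompact R N)
    {x y : N} (hxy : ∀ F : Finset ((N × N) ⊕ (R × N)), ∃ f : N → N,
      (∀ e ∈ F, Finsupp.linearCombination R f (linearityEquation R N e) = 0) ∧ f x = y) :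
    y ∈ Submodule.span (Module.End R N) {x} := by
  classical
  let ι : N →ₗ[R] (ULift.{max u v} ℕ →₀ N) := Finsupp.lsingle ⟨0⟩
  let π : (ULift.{max u v} ℕ →₀ N) →ₗ[R] N := Finsupp.lapply ⟨0⟩
  have hπι : ∀ n, π (ι n) = n := fun n => by simp [π, ι]
  obtain ⟨f, hf⟩ := (h (ULift.{max u v} ℕ)).exists_solution (J := N)
    (I := Option ((N × N) ⊕ (R × N)))
    (fun e => e.elim (Finsupp.single x 1) (linearityEquation R N)) (fun e => e.elim (ι y) 0)
    fun F => by
      obtain ⟨f, hf, hfx⟩ := hxy (Finset.eraseNone F)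
      refine ⟨ι ∘ f, fun e he => ?_⟩
      rcases e with _ | e
      · simp [hfx]
      · have := congrArg ι (hf e (by simpa using he))
        rw [Finsupp.apply_linearCombination] at this
        simpa using this
  have hlin : ∀ e, Finsupp.linearCombination R (π ∘ f) (linearityEquation R N e) = 0 :=
    fun e => by
      have := congrArg π (hf (some e))
      rw [Finsupp.apply_linearCombination] at this
      simpa using this
  refine Submodule.mem_span_singleton.2 ⟨linearMapOfLinearityEquation _ hlin, ?_⟩
  have := congrArg π (hf none)
  simpa [hπι] using! this

/-- A Σ-algebraically compact module satisfies the descending chain condition on cyclic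
submodules over its endomorphism ring. -/
theorem IsSigmaAlgebraicallyCompact.exists_mem_span_succ (h : IsSigmaAlgebraicallyCompact R N)
    (x : ℕ → N) (hx : ∀ n, x (n + 1) ∈ Submodule.span (Module.End R N) {x n}) :
    ∃ n, x n ∈ Submodule.span (Module.End R N) {x (n + 1)} := by
  classical
  by_contra! hcon
  have hF : ∀ n, ∃ F : Finset ((N × N) ⊕ (R × N)), ∀ f : N → N,
      (∀ e ∈ F, Finsupp.linearCombination R f (linearityEquation R N e) = 0) →
        f (x (n + 1)) ≠ x n := fun n => by
    by_contra! hn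
    exact hcon n (h.mem_span_singleton hn)
  choose F hF using hF
  have hg : ∀ n k, n < k → ∃ g : Module.End R N, g (x (n + 1)) = x k := by
    intro n k hnk
    induction k, hnk using Nat.le_induction with
    | base => exact ⟨1, rfl⟩
    | succ k _ ih =>
      obtain ⟨g, hg⟩ := ih
      obtain ⟨g', hg'⟩ := Submodule.mem_span_singleton.1 (hx k)
      exact ⟨g' * g, by rw [Module.End.mul_apply, hg]; exact hg'⟩
  choose! g hg using hg
  let ι (k : ℕ) : N →ₗ[R] (ULift.{max u v} ℕ →₀ N) := Finsupp.lsingle ⟨k⟩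
  let π (k : ℕ) : (ULift.{max u v} ℕ →₀ N) →ₗ[R] N := Finsupp.lapply ⟨k⟩
  have hπι : ∀ k l n, π k (ι l n) = if l = k then n else 0 := fun k l n => by
    simp [π, ι, Finsupp.single_apply]
  let s (n : ℕ) : ULift.{max u v} ℕ →₀ N := ∑ k ∈ Finset.range (n + 1), ι k (x k)
  have hs : ∀ n, π n (s n) = x n := fun n => by
    simp [s, map_sum, hπι]
  -- Unknowns: an element `z` (index `none`) and maps `f_n`; equations: `f_n (x (n + 1)) = z - s n`
  -- and the conditions `F n` on `f_n`. Up to level `L`, `z = s L` works.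
  obtain ⟨f, hf⟩ := (h (ULift.{max u v} ℕ)).exists_solution (J := Option (ℕ × N))
    (I := Σ n, Option {e // e ∈ F n})
    (fun i => i.2.elim (Finsupp.single (some (i.1, x (i.1 + 1))) 1 - Finsupp.single none 1)
      fun e => (linearityEquation R N e.1).mapDomain fun m => some (i.1, m))
    (fun i => i.2.elim (-s i.1) 0) fun G => by
      let L := G.sup Sigma.fst
      let X (n : ℕ) : N →ₗ[R] (ULift.{max u v} ℕ →₀ N) :=
        ∑ k ∈ Finset.Ico (n + 1) (L + 1), ι k ∘ₗ g n k
      refine ⟨fun j => j.elim (s L) fun p => X p.1 p.2, ?_⟩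
      rintro ⟨n, _ | e⟩ hi
      · have hn : n ≤ L := Finset.le_sup (f := Sigma.fst) hi
        have hX : X n (x (n + 1)) = ∑ k ∈ Finset.Ico (n + 1) (L + 1), ι k (x k) := by
          simp only [X, LinearMap.sum_apply, LinearMap.comp_apply]
          refine Finset.sum_congr rfl fun k hk => ?_
          rw [hg n k (Finset.mem_Ico.1 hk).1]
        have hsplit : s n + ∑ k ∈ Finset.Ico (n + 1) (L + 1), ι k (x k) = s L :=
          Finset.sum_range_add_sum_Ico _ (by omega)
        simp [hX, ← hsplit]
      · simpa [Finsupp.linearCombination_mapDomain] using!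
          linearCombination_linearityEquation (X n) e.1
  -- Finite support of `z` is the contradiction: where its coordinate `n` vanishes, `-π n ∘ f_n`
  -- satisfies `F n` and sends `x (n + 1)` to `x n`.
  obtain ⟨n, hn⟩ : ∃ n, π n (f none) = 0 := by
    obtain ⟨k, hk⟩ := Infinite.exists_notMem_finset (f none).support
    exact ⟨k.down, Finsupp.notMem_support_iff.1 hk⟩
  refine hF n (fun m => -π n (f (some (n, m)))) (fun e he => ?_) ?_
  · have := congrArg (fun y => -π n y) (hf ⟨n, some ⟨e, he⟩⟩)
    simp only [Option.elim, Finsupp.linearCombination_mapDomain] at this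
    rw [← LinearMap.neg_apply, Finsupp.apply_linearCombination] at this
    simpa using! this
  · have := congrArg (fun y => -π n y) (hf ⟨n, none⟩)
    simpa [hn, hs] using this

end AlgebraicallyCompact

/-! ### Simple submodules and passage to partial sums. -/

section CyclicDCC

/-- A nonzero element of `U` with minimal cyclic span generates a simple submodule. -/
theorem exists_isAtom_le_of_cyclic_dcc {S N : Type*} [Ring S] [AddCommGroup N] [Module S N]
    (h : ∀ x : ℕ → N, (∀ n, x (n + 1) ∈ Submodule.span S {x n}) →
      ∃ n, x n ∈ Submodule.span S {x (n + 1)})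
    {U : Submodule S N} (hU : U ≠ ⊥) : ∃ V ≤ U, IsAtom V := by
  have hwf : WellFounded fun y x : N => y ∈ Submodule.span S {x} ∧ x ∉ Submodule.span S {y} := by
    refine wellFounded_iff_isEmpty_descending_chain.2 ⟨fun ⟨x, hx⟩ => ?_⟩
    obtain ⟨n, hn⟩ := h x fun n => (hx n).1
    exact (hx n).2 hn
  obtain ⟨x₀, hx₀, hx₀'⟩ := Submodule.exists_mem_ne_zero_of_ne_bot hU
  obtain ⟨x, ⟨hxU, hx⟩, hmin⟩ := hwf.has_min {x | x ∈ U ∧ x ≠ 0} ⟨x₀, hx₀, hx₀'⟩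
  refine ⟨Submodule.span S {x}, Submodule.span_le.2 (by simpa using hxU),
    mt Submodule.span_singleton_eq_bot.1 hx, fun W hW => ?_⟩
  by_contra hW0
  obtain ⟨y, hyW, hy⟩ := Submodule.exists_mem_ne_zero_of_ne_bot hW0
  have hyx := hW.le hyW
  refine hW.not_ge (Submodule.span_le.2 ?_)
  have hyU : y ∈ U := Submodule.span_le.2 (by simpa using hxU) hyx
  have hxy : x ∈ Submodule.span S {y} := by
    by_contra hxy
    exact hmin y ⟨hyU, hy⟩ ⟨hyx, hxy⟩
  simpa using Submodule.span_le.2 (by simpa using hyW) hxy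

variable {R : Type*} [Ring R]

theorem cyclic_dcc_of_retract {N N' : Type*} [AddCommGroup N] [Module R N] [AddCommGroup N']
    [Module R N'] (ι : N' →ₗ[R] N) (π : N →ₗ[R] N') (hπι : ∀ x, π (ι x) = x)
    (h : ∀ x : ℕ → N, (∀ n, x (n + 1) ∈ Submodule.span (Module.End R N) {x n}) →
      ∃ n, x n ∈ Submodule.span (Module.End R N) {x (n + 1)})
    (x : ℕ → N') (hx : ∀ n, x (n + 1) ∈ Submodule.span (Module.End R N') {x n}) :
    ∃ n, x n ∈ Submodule.span (Module.End R N') {x (n + 1)} := by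
  obtain ⟨n, hn⟩ := h (fun n => ι (x n)) fun n => by
    obtain ⟨f, hf⟩ := Submodule.mem_span_singleton.1 (hx n)
    refine Submodule.mem_span_singleton.2 ⟨ι ∘ₗ f ∘ₗ π, ?_⟩
    simpa [hπι] using! congrArg ι hf
  obtain ⟨f, hf⟩ := Submodule.mem_span_singleton.1 hn
  exact ⟨n, Submodule.mem_span_singleton.2 ⟨π ∘ₗ f ∘ₗ ι, (congrArg π hf).trans (hπι _)⟩⟩

theorem exists_retract_directSum {I κ : Type*} {M : I → Type*} [∀ i, AddCommGroup (M i)]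
    [∀ i, Module R (M i)] {j : κ → I} (hj : Function.Injective j) :
    ∃ (ι : (⨁ k, M (j k)) →ₗ[R] ⨁ i, M i) (π : (⨁ i, M i) →ₗ[R] ⨁ k, M (j k)),
      ∀ x, π (ι x) = x := by
  classical
  let π : (⨁ i, M i) →ₗ[R] ⨁ k, M (j k) :=
    { toFun := DFinsupp.comapDomain j hj
      map_add' := DFinsupp.comapDomain_add j hj
      map_smul' := DFinsupp.comapDomain_smul j hj }
  let ι : (⨁ k, M (j k)) →ₗ[R] ⨁ i, M i :=
    DirectSum.toModule R κ _ fun k => DirectSum.lof R I M (j k)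
  refine ⟨ι, π, fun x => ?_⟩
  have : π ∘ₗ ι = LinearMap.id := DirectSum.linearMap_ext _ fun k => LinearMap.ext fun y => by
    have hι : ι (DirectSum.lof R κ (fun k => M (j k)) k y) = DirectSum.lof R I M (j k) y :=
      DirectSum.toModule_lof (M := fun k => M (j k)) R k y
    change π (ι _) = _
    rw [hι]
    exact DFinsupp.comapDomain_single j hj k y
  exact congrArg (fun f : (⨁ k, M (j k)) →ₗ[R] ⨁ k, M (j k) => f x) this

end CyclicDCC

/-! ### Finitely cogenerated quotients. -/

section FinitelyCogenerated

/-- A nonzero element can be separated from zero by a finitely cogenerated factor module. -/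
theorem exists_isFinitelyCogenerated_quotient {R N : Type*} [Ring R] [AddCommGroup N]
    [Module R N] {a : N} (ha : a ≠ 0) :
    ∃ X : Submodule R N, a ∉ X ∧ IsFinitelyCogenerated R (N ⧸ X) := by
  obtain ⟨X, -, hX⟩ := zorn_le_nonempty₀ {X : Submodule R N | a ∉ X}
    (fun c hc hchain Y hY => ⟨sSup c, fun h => by
      obtain ⟨Z, hZ, haZ⟩ := (Submodule.mem_sSup_of_directed ⟨Y, hY⟩ hchain.directedOn).1 h
      exact hc hZ haZ, fun Z hZ => le_sSup hZ⟩) ⊥ (by simpa using ha)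
  refine ⟨X, hX.prop, fun F hF => ?_⟩
  -- Some `Y ∈ F` misses the image of `a`; by maximality of `X` such a `Y` is already zero.
  obtain ⟨Y, hY, haY⟩ : ∃ Y ∈ F, X.mkQ a ∉ Y := by
    by_contra! h
    have : X.mkQ a ∈ sInf F := Submodule.mem_sInf.2 h
    rw [hF, Submodule.mem_bot] at this
    exact hX.prop (by simpa using this)
  refine ⟨{Y}, Set.singleton_subset_iff.2 hY, Set.finite_singleton Y, ?_⟩
  have hle : X ≤ Y.comap X.mkQ := fun x hx => by simp [(Submodule.Quotient.mk_eq_zero X).2 hx]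
  have heq : Y.comap X.mkQ ≤ X := hX.le_of_ge (y := Y.comap X.mkQ) haY hle
  rw [sInf_singleton, Submodule.eq_bot_iff]
  intro y hy
  obtain ⟨x, rfl⟩ := X.mkQ_surjective y
  simpa using heq hy

end FinitelyCogenerated

/-! ### Finite support and chain condition for the endosocle. -/

section Socle

variable {R : Type*} [Ring R] {κ : Type*} {M : κ → Type*} [∀ i, AddCommGroup (M i)]
  [∀ i, Module R (M i)]

theorem IsLeftSemiTNilpotent.comp {ι : Type*} (h : IsLeftSemiTNilpotent R M) {j : ι → κ}
    (hj : Function.Injective j) : IsLeftSemiTNilpotent R (fun i => M (j i)) := by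
  intro i hi f hf X hX
  obtain ⟨n, hn⟩ := h (fun n => j (i n)) (hj.comp hi) f hf X hX
  have hcomp : ∀ n, backwardComp (M := fun i => M (j i)) i f n =
      backwardComp (M := M) (fun n => j (i n)) f n := by
    intro n
    induction n with
    | zero => rfl
    | succ n ih => exact congrArg (fun g : M (j (i n)) →ₗ[R] M (j (i 0)) => g ∘ₗ f n) ih
  exact ⟨n, by rw [hcomp]; exact hn⟩

/-- Any nonzero element of a simple `U` generates it. Nonzero `x n` at infinitely many distinct
indices are thus linked by maps `x (n + 1) ↦ x n`, whose composites always hit `x 0`. -/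
theorem IsLeftSemiTNilpotent.finite_homogeneousPart_of_isAtom [DecidableEq κ]
    (hM : ∀ s t, s ≠ t → ∀ f : M s →ₗ[R] M t, ¬ Function.Bijective f)
    (h : IsLeftSemiTNilpotent R M) {U : Submodule (Module.End R (⨁ i, M i)) (⨁ i, M i)}
    (hU : IsAtom U) : {k | homogeneousPart U k ≠ ⊥}.Finite := by
  by_contra hinf
  let a := Set.Infinite.natEmbedding _ hinf
  have hx : ∀ n, ∃ x : M (a n).1, DirectSum.lof R κ M (a n).1 x ∈ U ∧ x ≠ 0 := fun n =>
    Submodule.exists_mem_ne_zero_of_ne_bot (a n).2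
  choose x hxU hx using hx
  have hg : ∀ n, ∃ g : M (a (n + 1)).1 →ₗ[R] M (a n).1, g (x (n + 1)) = x n := by
    intro n
    have hspan : DirectSum.lof R κ M (a n).1 (x n) ∈ Submodule.span (Module.End R (⨁ i, M i))
        {DirectSum.lof R κ M (a (n + 1)).1 (x (n + 1))} := by
      rcases hU.le_iff.1 (Submodule.span_le.2 (Set.singleton_subset_iff.2 (hxU (n + 1))))
        with h0 | h1
      · have := congrArg (DirectSum.component R κ M (a (n + 1)).1)
          (Submodule.span_singleton_eq_bot.1 h0)
        exact absurd (by simpa using this) (hx (n + 1))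
      · rw [h1]
        exact hxU n
    obtain ⟨s, hs⟩ := Submodule.mem_span_singleton.1 hspan
    refine ⟨DirectSum.component R κ M _ ∘ₗ s ∘ₗ DirectSum.lof R κ M _, ?_⟩
    simpa using! congrArg (DirectSum.component R κ M (a n).1) hs
  choose g hg using hg
  obtain ⟨X, hxX, hX⟩ := exists_isFinitelyCogenerated_quotient (R := R) (hx 0)
  have hinj : Function.Injective fun n => (a n).1 := Subtype.val_injective.comp a.injective
  obtain ⟨n, hn⟩ := h (fun n => (a n).1) hinj g
    (fun n => hM _ _ (hinj.ne n.succ_ne_self) _) X hX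
  have hcomp : ∀ n, backwardComp (M := M) (fun n => (a n).1) g n (x n) = x 0 := by
    intro n
    induction n with
    | zero => rfl
    | succ n ih => exact (congrArg (backwardComp (fun n => (a n).1) g n) (hg n)).trans ih
  exact hxX (hn ⟨x n, hcomp n⟩)

theorem IsLeftSemiTNilpotent.finite_homogeneousPart_endosocle [DecidableEq κ]
    (hM : ∀ s t, s ≠ t → ∀ f : M s →ₗ[R] M t, ¬ Function.Bijective f)
    (h : IsLeftSemiTNilpotent R M) (hfg : (endosocle R (⨁ i, M i)).FG) :
    {k | homogeneousPart (endosocle R (⨁ i, M i)) k ≠ ⊥}.Finite := by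
  obtain ⟨F, hF, hle⟩ := (CompleteLattice.isCompactElement_iff_exists_le_sSup_of_le_sSup _ _).1
    ((Submodule.fg_iff_compact _).1 hfg) _ le_rfl
  refine (F.finite_toSet.biUnion fun U hU => h.finite_homogeneousPart_of_isAtom hM
    (isSimpleModule_iff_isAtom.1 (hF hU))).subset fun k hk => ?_
  obtain ⟨x, hx, hx0⟩ := Submodule.exists_mem_ne_zero_of_ne_bot hk
  by_contra hcon
  have hbot : ∀ U ∈ F, homogeneousPart U k = ⊥ := by simpa using hcon
  have hsup : F.sup id ≤ fullyInvariantHull k ⊥ := Finset.sup_le fun U hU y hy g =>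
    hbot U hU ▸ lof_apply_mem U hy g
  exact hx0 (lof_mem_fullyInvariantHull.1 (hsup (hle hx)))

theorem isArtinian_socle {S N : Type*} [Ring S] [AddCommGroup N] [Module S N]
    (hfg : (socle S N).FG) : IsArtinian S (socle S N) := by
  have : IsSemisimpleModule S (socle S N) := by
    rw [socle, sSup_eq_iSup]
    exact isSemisimpleModule_biSup_of_isSemisimpleModule_submodule fun U hU =>
      have : IsSimpleModule S U := hU
      inferInstance
  have : Module.Finite S (socle S N) := Module.Finite.iff_fg.2 hfg
  exact (IsSemisimpleModule.finite_tfae.out 0 2).1 this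

/-- The hull embeds chains at index `k` into the submodules of the endosocle, which is finitely
generated semisimple, hence artinian. -/
theorem exists_stable_of_antitone_le_endosocle [DecidableEq κ]
    (hfg : (endosocle R (⨁ i, M i)).FG) (k : κ)
    {V : ℕ → Submodule (Module.End R (M k)) (M k)} (hV : Antitone V)
    (hle : ∀ n, V n ≤ homogeneousPart (endosocle R (⨁ i, M i)) k) :
    ∃ n, ∀ m, n ≤ m → V n = V m := by
  have : IsArtinian (Module.End R (⨁ i, M i)) (endosocle R (⨁ i, M i)) := isArtinian_socle hfg
  obtain ⟨n, hn⟩ := IsArtinian.monotone_stabilizes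
    (⟨fun n => OrderDual.toDual ((fullyInvariantHull k (V n)).comap
      (endosocle R (⨁ i, M i)).subtype), fun m m' hm =>
        Submodule.comap_mono (fullyInvariantHull_le_iff.2 (hV hm))⟩ :
      ℕ →o (Submodule (Module.End R (⨁ i, M i)) (endosocle R (⨁ i, M i)))ᵒᵈ)
  refine ⟨n, fun m hm => le_antisymm (fun x hx => ?_) (hV hm)⟩
  have heq := OrderDual.toDual.injective (hn m hm)
  have hmem : (⟨DirectSum.lof R κ M k x, hle n hx⟩ : endosocle R (⨁ i, M i)) ∈
      (fullyInvariantHull k (V n)).comap (endosocle R (⨁ i, M i)).subtype :=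
    lof_mem_fullyInvariantHull.2 hx
  rw [heq] at hmem
  exact lof_mem_fullyInvariantHull.1 hmem

theorem exists_map_mem_endosocle [DecidableEq κ]
    (hat : ∀ U : Submodule (Module.End R (⨁ i, M i)) (⨁ i, M i), U ≠ ⊥ → ∃ V ≤ U, IsAtom V)
    {s : κ} {x : M s} (hx : x ≠ 0) :
    ∃ t, ∃ g : M s →ₗ[R] M t, g x ∈ homogeneousPart (endosocle R (⨁ i, M i)) t ∧ g x ≠ 0 := by
  have hx' : DirectSum.lof R κ M s x ≠ 0 := fun h => hx (by
    simpa using congrArg (DirectSum.component R κ M s) h)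
  obtain ⟨V, hV, hVat⟩ := hat (Submodule.span _ {DirectSum.lof R κ M s x})
    (mt Submodule.span_singleton_eq_bot.1 hx')
  obtain ⟨v, hvV, hv⟩ := Submodule.exists_mem_ne_zero_of_ne_bot hVat.1
  obtain ⟨t, ht⟩ : ∃ t, v t ≠ 0 := by
    by_contra! h
    exact hv (DFinsupp.ext h)
  obtain ⟨f, hf⟩ := Submodule.mem_span_singleton.1 (hV hvV)
  have hgx : (DirectSum.component R κ M t ∘ₗ f ∘ₗ DirectSum.lof R κ M s) x = v t :=
    congrArg (DirectSum.component R κ M t) hf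
  refine ⟨t, DirectSum.component R κ M t ∘ₗ f ∘ₗ DirectSum.lof R κ M s, ?_, hgx ▸ ht⟩
  rw [hgx]
  have hle : V ≤ endosocle R (⨁ i, M i) := le_sSup (isSimpleModule_iff_isAtom.2 hVat)
  exact lof_apply_mem _ (hle hvV) (DirectSum.component R κ M t)

end Socle

/-! ### Mittag-Leffler descent through the layers. -/

section Descent

variable {R : Type*} [Ring R] {T : Type*} {M : T → Type*} [∀ i, AddCommGroup (M i)]
  [∀ i, Module R (M i)]

/-- The submodule of `M t` generated by the images of the `V s` under homomorphisms. -/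
def homTrace (V : ∀ s, Submodule (Module.End R (M s)) (M s)) (t : T) :
    Submodule (Module.End R (M t)) (M t) :=
  Submodule.span _ {y | ∃ s, ∃ f : M s →ₗ[R] M t, ∃ z ∈ V s, f z = y}

theorem homTrace_mono {V V' : ∀ s, Submodule (Module.End R (M s)) (M s)} (h : ∀ s, V s ≤ V' s)
    (t : T) : homTrace V t ≤ homTrace V' t :=
  Submodule.span_mono fun _ ⟨s, f, z, hz, hy⟩ => ⟨s, f, z, h s hz, hy⟩

theorem exists_map_notMem_of_mem_homTrace {V : ∀ s, Submodule (Module.End R (M s)) (M s)} {t : T}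
    {z : M t} (hz : z ∈ homTrace V t) {X : Submodule R (M t)} (hzX : z ∉ X) :
    ∃ s, ∃ f : M s →ₗ[R] M t, ∃ y ∈ V s, f y ∉ X := by
  by_contra! hcon
  -- `X` is only an `R`-submodule, so the induction must carry all `e z`.
  have : ∀ e : Module.End R (M t), e z ∈ X := by
    refine Submodule.span_induction (p := fun z _ => ∀ e : Module.End R (M t), e z ∈ X)
      ?_ (fun e => by simp) (fun x y _ _ hx hy e => by simpa using X.add_mem (hx e) (hy e))
      (fun a x _ hx e => hx (e * a)) hz
    rintro _ ⟨s, f, y, hy, rfl⟩ e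
    exact hcon s (e ∘ₗ f) y hy
  exact hzX (this 1)

/-- `socleDescent V m k t` consists of the elements of `V k t` obtained from `V (k + m)` through
`m` successive homomorphisms passing through `V (k + m - 1), …, V (k + 1)`. -/
def socleDescent (V : ℕ → ∀ t, Submodule (Module.End R (M t)) (M t)) :
    ℕ → ℕ → ∀ t, Submodule (Module.End R (M t)) (M t)
  | 0, k => V k
  | m + 1, k => fun t => V k t ⊓ homTrace (socleDescent V m (k + 1)) t

variable {V : ℕ → ∀ t, Submodule (Module.End R (M t)) (M t)}

theorem socleDescent_le (m k : ℕ) (t : T) : socleDescent V m k t ≤ V k t := by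
  cases m with
  | zero => exact le_rfl
  | succ m => exact inf_le_left

theorem socleDescent_antitone (k : ℕ) (t : T) : Antitone fun m => socleDescent V m k t := by
  refine antitone_nat_of_succ_le fun m => ?_
  induction m generalizing k t with
  | zero => exact inf_le_left
  | succ m ih => exact inf_le_inf_left _ (homTrace_mono (fun s => ih (k + 1) s) t)

theorem exists_mem_socleDescent (hne : ∀ k, ∃ t, V k t ≠ ⊥)
    (hstep : ∀ k s, ∀ x ∈ V (k + 1) s, x ≠ 0 → ∃ t, ∃ g : M s →ₗ[R] M t, g x ∈ V k t ∧ g x ≠ 0)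
    (m k : ℕ) : ∃ t, socleDescent V m k t ≠ ⊥ := by
  induction m generalizing k with
  | zero => exact hne k
  | succ m ih =>
    obtain ⟨s, hs⟩ := ih (k + 1)
    obtain ⟨x, hx, hx0⟩ := Submodule.exists_mem_ne_zero_of_ne_bot hs
    obtain ⟨t, g, hg, hg0⟩ := hstep k s x (socleDescent_le m (k + 1) s hx) hx0
    exact ⟨t, (Submodule.ne_bot_iff _).2
      ⟨g x, ⟨hg, Submodule.subset_span ⟨s, g, x, hx, rfl⟩⟩, hg0⟩⟩

/-- Only finitely many `t` are nonzero in `V k`, so the stabilisation indices have a common bound.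
-/
theorem exists_uniform_stable (hfin : ∀ k, {t | V k t ≠ ⊥}.Finite)
    (hstable : ∀ k t, ∀ W : ℕ → Submodule (Module.End R (M t)) (M t), Antitone W →
      (∀ n, W n ≤ V k t) → ∃ n, ∀ m, n ≤ m → W n = W m) (k : ℕ) :
    ∃ n, ∀ t, ∀ m, n ≤ m → socleDescent V n k t = socleDescent V m k t := by
  choose n hn using fun t => hstable k t (fun m => socleDescent V m k t)
    (socleDescent_antitone k t) (fun m => socleDescent_le m k t)
  refine ⟨(hfin k).toFinset.sup n, fun t m hm => ?_⟩
  by_cases ht : V k t = ⊥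
  · rw [le_bot_iff.1 ((socleDescent_le _ k t).trans ht.le),
      le_bot_iff.1 ((socleDescent_le m k t).trans ht.le)]
  · have hle : n t ≤ (hfin k).toFinset.sup n := Finset.le_sup (by simpa using ht)
    rw [← hn t _ hle, ← hn t _ (hle.trans hm)]

/-- The stable parts `L k` satisfy `L k ≤ homTrace (L (k + 1))`, and `L 0` is nonzero. Elements of a
trace are sums of images and need not lift along one map, so submodules not containing `L k` are
pulled back instead. -/
theorem not_isLeftSemiTNilpotent_of_descent
    (hM : ∀ s t, s ≠ t → ∀ f : M s →ₗ[R] M t, ¬ Function.Bijective f)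
    (hfin : ∀ k, {t | V k t ≠ ⊥}.Finite)
    (hdisj : ∀ k l t, V k t ≠ ⊥ → V l t ≠ ⊥ → k = l)
    (hne : ∀ k, ∃ t, V k t ≠ ⊥)
    (hstep : ∀ k s, ∀ x ∈ V (k + 1) s, x ≠ 0 → ∃ t, ∃ g : M s →ₗ[R] M t, g x ∈ V k t ∧ g x ≠ 0)
    (hstable : ∀ k t, ∀ W : ℕ → Submodule (Module.End R (M t)) (M t), Antitone W →
      (∀ n, W n ≤ V k t) → ∃ n, ∀ m, n ≤ m → W n = W m) :
    ¬ IsLeftSemiTNilpotent R M := by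
  intro hnil
  choose n hn using exists_uniform_stable hfin hstable
  let L (k : ℕ) : ∀ t, Submodule (Module.End R (M t)) (M t) := socleDescent V (n k) k
  have hLV : ∀ k t, L k t ≤ V k t := fun k t => socleDescent_le _ k t
  have hLtrace : ∀ k t, L k t ≤ homTrace (L (k + 1)) t := by
    intro k t x hx
    -- The `+ 1` pays for one trace step, leaving an index at least `n (k + 1)` at level `k + 1`.
    have hx' : x ∈ socleDescent V (max (n k) (n (k + 1)) + 1) k t := by
      rw [← hn k t _ (by omega)]
      exact hx
    exact homTrace_mono (fun s => (hn (k + 1) s _ (le_max_right _ _)).ge) t hx'.2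
  obtain ⟨t₀, ht₀⟩ := exists_mem_socleDescent hne hstep (n 0) 0
  obtain ⟨a, haL, ha⟩ := Submodule.exists_mem_ne_zero_of_ne_bot ht₀
  obtain ⟨X₀, haX, hX₀⟩ := exists_isFinitelyCogenerated_quotient (R := R) ha
  let σ (k : ℕ) := {p : Σ t, Submodule R (M t) // ∃ z ∈ L k p.1, z ∉ p.2}
  have step : ∀ k, ∀ p : σ k, ∃ q : σ (k + 1), ∃ f : M q.1.1 →ₗ[R] M p.1.1,
      q.1.2 = p.1.2.comap f := by
    rintro k ⟨⟨t, X⟩, z, hz, hzX⟩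
    obtain ⟨s, f, y, hy, hyX⟩ := exists_map_notMem_of_mem_homTrace (hLtrace k t hz) hzX
    exact ⟨⟨⟨s, X.comap f⟩, y, hy, hyX⟩, f, rfl⟩
  choose next f hf using step
  let p : ∀ k, σ k := fun k => Nat.rec ⟨⟨t₀, X₀⟩, a, haL, haX⟩ (fun k => next k) k
  have hinj : Function.Injective fun k => (p k).1.1 := by
    have hpV : ∀ k, V k (p k).1.1 ≠ ⊥ := fun k => by
      obtain ⟨z, hz, hzX⟩ := (p k).2
      exact (Submodule.ne_bot_iff _).2 ⟨z, hLV k _ hz, fun h => hzX (h ▸ zero_mem _)⟩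
    intro k l hkl
    refine hdisj k l _ (hpV k) ?_
    have := hpV l
    simp only at hkl
    rwa [← hkl] at this
  have hcomap : ∀ m, (p m).1.2 =
      X₀.comap (backwardComp (M := M) (fun k => (p k).1.1) (fun k => f k (p k)) m) := by
    intro m
    induction m with
    | zero => rfl
    | succ m ih =>
      refine (hf m (p m)).trans ?_
      rw [ih]
      rfl
  obtain ⟨m, hm⟩ := hnil (fun k => (p k).1.1) hinj (fun k => f k (p k))
    (fun k => hM _ _ (hinj.ne k.succ_ne_self) _) X₀ hX₀
  obtain ⟨z, -, hz⟩ := (p m).2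
  rw [hcomap m] at hz
  exact hz (hm ⟨z, rfl⟩)

end Descent

/-! ### Peeling off endosocles; proof of (II). -/

section Transversal

variable {R : Type*} [Ring R] {T : Type*} {M : T → Type*} [∀ i, AddCommGroup (M i)]
  [∀ i, Module R (M i)]

open Classical in
variable (R M) in
/-- The homogeneous component at `t` of the endosocle of `⨁ t : T', M t`, which is zero for
`t ∉ T'`. -/
noncomputable def endosocleAt (T' : Set T) (t : T) : Submodule (Module.End R (M t)) (M t) :=
  if h : t ∈ T' then homogeneousPart (M := fun t : T' => M t) (endosocle R (⨁ t : T', M t)) ⟨t, h⟩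
  else ⊥

open Classical in
theorem endosocleAt_of_mem {T' : Set T} {t : T} (h : t ∈ T') : endosocleAt R M T' t =
    homogeneousPart (M := fun t : T' => M t) (endosocle R (⨁ t : T', M t)) ⟨t, h⟩ :=
  dif_pos h

theorem mem_of_endosocleAt_ne_bot {T' : Set T} {t : T} (h : endosocleAt R M T' t ≠ ⊥) : t ∈ T' := by
  by_contra ht
  exact h (dif_neg ht)

variable (R M) in
/-- The index sets obtained by successively removing the indices occurring in the endosocle. -/
noncomputable def endosocleComplement : ℕ → Set T
  | 0 => Set.univ
  | k + 1 => endosocleComplement k \ {t | endosocleAt R M (endosocleComplement k) t ≠ ⊥}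

theorem endosocleComplement_antitone : Antitone (endosocleComplement R M) :=
  antitone_nat_of_succ_le fun _ => Set.sdiff_subset

/-- For infinite `T` every peeled index set stays cofinite, hence nonempty with finitely generated
endosocle. An element of layer `k + 1` has its index in the `k`-th set, so it maps nontrivially into
layer `k`. -/
theorem finite_of_isLeftSemiTNilpotent (hnt : ∀ t, Nontrivial (M t))
    (hM : ∀ s t, s ≠ t → ∀ f : M s →ₗ[R] M t, ¬ Function.Bijective f)
    (hat : ∀ T' : Set T, ∀ U : Submodule (Module.End R (⨁ t : T', M t)) (⨁ t : T', M t),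
      U ≠ ⊥ → ∃ V ≤ U, IsAtom V)
    (hnil : IsLeftSemiTNilpotent R M)
    (hfg : ∀ T' : Set T, T'ᶜ.Finite → (endosocle R (⨁ t : T', M t)).FG) : Finite T := by
  classical
  by_contra hinf
  rw [not_finite_iff_infinite] at hinf
  have hfin : ∀ T' : Set T, T'ᶜ.Finite → {t | endosocleAt R M T' t ≠ ⊥}.Finite := by
    intro T' hT'
    have h := IsLeftSemiTNilpotent.finite_homogeneousPart_endosocle (M := fun t : T' => M t)
      (fun s t hst => hM s t (Subtype.val_injective.ne hst))
      (hnil.comp Subtype.val_injective) (hfg T' hT')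
    refine (h.image Subtype.val).subset fun t ht => ?_
    have htT' := mem_of_endosocleAt_ne_bot ht
    rw [Set.mem_ofPred_eq, endosocleAt_of_mem htT'] at ht
    exact ⟨⟨t, htT'⟩, ht, rfl⟩
  have hmap : ∀ T' : Set T, ∀ s ∈ T', ∀ x : M s, x ≠ 0 →
      ∃ t, ∃ g : M s →ₗ[R] M t, g x ∈ endosocleAt R M T' t ∧ g x ≠ 0 := by
    intro T' s hs x hx
    obtain ⟨t, g, hg, hg0⟩ := exists_map_mem_endosocle (M := fun t : T' => M t) (hat T')
      (s := ⟨s, hs⟩) hx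
    refine ⟨t, g, ?_, hg0⟩
    rw [endosocleAt_of_mem t.2]
    exact hg
  set C := endosocleComplement R M with hC
  have hCsucc : ∀ k, C (k + 1) = C k \ {t | endosocleAt R M (C k) t ≠ ⊥} := fun k => rfl
  have hcof : ∀ k, (C k)ᶜ.Finite := by
    intro k
    induction k with
    | zero => simp [hC, endosocleComplement]
    | succ k ih =>
      rw [hCsucc, Set.compl_sdiff]
      exact (hfin _ ih).union ih
  have hlt : ∀ k l t, k < l → endosocleAt R M (C k) t ≠ ⊥ → endosocleAt R M (C l) t = ⊥ := by
    intro k l t hkl hk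
    by_contra hl
    have : t ∈ C (k + 1) := endosocleComplement_antitone hkl (mem_of_endosocleAt_ne_bot hl)
    exact this.2 hk
  refine not_isLeftSemiTNilpotent_of_descent (V := fun k => endosocleAt R M (C k)) hM
    (fun k => hfin _ (hcof k)) (fun k l t hk hl => ?_) (fun k => ?_) (fun k s x hx hx0 => ?_)
    (fun k t W hW hle => ?_) hnil
  · rcases lt_trichotomy k l with h | h | h
    · exact absurd (hlt k l t h hk) hl
    · exact h
    · exact absurd (hlt l k t h hl) hk
  · obtain ⟨s, hs⟩ := (hcof k).infinite_compl.nonempty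
    rw [compl_compl] at hs
    obtain ⟨x, hx⟩ := exists_ne (0 : M s)
    obtain ⟨t, g, hg, hg0⟩ := hmap (C k) s hs x hx
    exact ⟨t, (Submodule.ne_bot_iff _).2 ⟨_, hg, hg0⟩⟩
  · have hs : s ∈ C (k + 1) := mem_of_endosocleAt_ne_bot ((Submodule.ne_bot_iff _).2 ⟨x, hx, hx0⟩)
    exact hmap (C k) s hs.1 x hx0
  · by_cases ht : t ∈ C k
    · rw [endosocleAt_of_mem ht] at hle
      exact exists_stable_of_antitone_le_endosocle (M := fun t : C k => M t) (hfg _ (hcof k))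
        ⟨t, ht⟩ hW hle
    · have hbot : ∀ n, W n = ⊥ := fun n => by
        by_contra hn
        exact ht (mem_of_endosocleAt_ne_bot (ne_bot_of_le_ne_bot hn (hle n)))
      exact ⟨0, fun m _ => by rw [hbot, hbot]⟩

end Transversal

end EndoStructure

theorem corollaryI {R : Type*} [Ring R] {I : Type*} (M : I → Type*)
    [∀ i, AddCommGroup (M i)] [∀ i, Module R (M i)]
    (hM : ∀ i, EndoStructure.IsIndecomposable R (M i))
    (T : Set I) (hT : EndoStructure.IsTransversal R M T) :
    ((EndoStructure.IsEndoNoetherian R (⨁ i, M i) ∧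
        EndoStructure.IsRightTNilpotent R (fun t : T => M t)) ↔
      (T.Finite ∧ ∀ t ∈ T, EndoStructure.IsEndofinite R (M t))) ∧
    (EndoStructure.IsSigmaAlgebraicallyCompact R (⨁ i, M i) →
      EndoStructure.IsLeftSemiTNilpotent R (fun t : T => M t) →
      (∀ T' : Set T, T'ᶜ.Finite →
        (EndoStructure.endosocle R (⨁ t : T', M t)).FG) →
      T.Finite) := by
  refine ⟨⟨fun h => hT.finite_and_isEndofinite hM h.1 h.2, fun h => ⟨?_, ?_⟩⟩,
    fun hac hnil hfg => ?_⟩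
  · exact hT.isNoetherian_directSum h.1 fun t ht =>
      (isFiniteLength_iff_isNoetherian_isArtinian.1 (h.2 t ht)).1
  · exact hT.isRightTNilpotent hM h.1 h.2
  · refine EndoStructure.finite_of_isLeftSemiTNilpotent (M := fun t : T => M t)
      (fun t => (hM t).1) (fun s t hst f hf => ?_) (fun T' U hU => ?_) hnil hfg
    · exact hst (Subtype.ext (hT.eq_of_bijective s.2 t.2 hf))
    · obtain ⟨ι, π, hπι⟩ := EndoStructure.exists_retract_directSum (R := R) (M := M)
        (j := fun t : T' => ((t : T) : I))
        (Subtype.val_injective.comp Subtype.val_injective)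
      exact EndoStructure.exists_isAtom_le_of_cyclic_dcc
        (EndoStructure.cyclic_dcc_of_retract ι π hπι hac.exists_mem_span_succ) hU
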